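/- Let $n\ge 2$ and $K\in\mathbb R$. There is a constant $C=C(n,K)>0$ with the following property. Let $\Omega\subset\mathbb R^n$ be a bounded open set with smooth boundary, and let $u$ be a real function that is smooth up to the boundary (that is, in a neighbourhood of $\overline\Omega$), with $|Du|<1$ on $\overline\Omega$ and $u=c$ on $\partial\Omega$ for some constant $c$. Thus the graph $M=\{(x,u(x)):x\in\Omega\}$ is a space-like hypersurface of the Minkowski space $\mathbb R^{n,1}$, with metric $dx_1^2+\cdots+dx_n^2-dx_{n+1}^2$, and its boundary lies in the hyperplane $\mathbb R^n\times\{c\}$. Let $$\phi=(x,u(x)),\quad e_{n+1}=\frac{(Du,1)}{\sqrt{1-|Du|^2}},\quad g_{ij}=\langle\partial_i\phi,\partial_j\phi\rangle,\quad h_{ij}=\langle\partial_i\phi,\partial_je_{n+1}\rangle,\quad h_i^j=g^{jk}h_{ik},$$ and suppose that the mean curvature $h_i^i$ of $M$ is a constant $H\in\mathbb R$. Let $\bar h_i^j=h_i^j-\frac1nH\delta_i^j$ be the trace-free second fundamental form, with $|\bar h|^2=\bar h_i^j\bar h_j^i$. Suppose that $$\frac1{\sqrt{1-|Du|^2}}\le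 K\quad\text{on }\partial\Omega .$$ Then $$\operatorname{div}\left(\frac{Du}{\sqrt{1-|Du|^2}}\right)=H\quad\text{in }\Omega,$$ and $$\|\bar h\|_{L^2(\Omega)}\le C(n,K)\,\|H_0-H_{\partial\Omega}\|_{L^1(\partial\Omega)}^{1/2},\qquad H_0=\frac{|\partial\Omega|}{n|\Omega|},$$ where $H_{\partial\Omega}$ is the mean curvature of $\partial\Omega$ with respect to the outer normal, normalized as the average of the $n-1$ principal curvatures and positive for balls. The $L^2(\Omega)$ norm is taken with respect to Lebesgue measure $dx$, and the $L^1(\partial\Omega)$ norm with respect to surface measure. -/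

import Mathlib

open MeasureTheory Topology
open scoped ContDiff ENNReal Matrix

namespace SpacelikeGraph

noncomputable section

variable {n : ℕ}

/-! ### Calculus in coordinates -/

/-- The `i`-th partial derivative of a map defined on `ℝⁿ`. -/
def partialDeriv {F : Type*} [NormedAddCommGroup F] [NormedSpace ℝ F]
    (i : Fin n) (f : EuclideanSpace ℝ (Fin n) → F) (x : EuclideanSpace ℝ (Fin n)) : F :=
  fderiv ℝ f x (EuclideanSpace.single i 1)

/-- The divergence `∑ᵢ Dᵢ Xᵢ` of a vector field on `ℝⁿ`. -/
def divergence (X : EuclideanSpace ℝ (Fin n) → EuclideanSpace ℝ (Fin n))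
    (x : EuclideanSpace ℝ (Fin n)) : ℝ :=
  ∑ i, partialDeriv i X x i

/-! ### Graphs in Minkowski space -/

/-- The Lorentzian product `x₁y₁ + ⋯ + xₙyₙ - xₙ₊₁yₙ₊₁` of `ℝ^{n,1}`; a point of `ℝ^{n,1}` is
written as `(x, t)` with `x ∈ ℝⁿ` and `t = xₙ₊₁`. -/
def lorentz (p q : EuclideanSpace ℝ (Fin n) × ℝ) : ℝ :=
  inner ℝ p.1 q.1 - p.2 * q.2

/-- The position vector `φ(x) = (x, u(x))` of the graph `M` of `u`. -/
def position (u : EuclideanSpace ℝ (Fin n) → ℝ) (x : EuclideanSpace ℝ (Fin n)) :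
    EuclideanSpace ℝ (Fin n) × ℝ :=
  (x, u x)

/-- `w = √(1 - |Du|²)`. -/
def lapse (u : EuclideanSpace ℝ (Fin n) → ℝ) (x : EuclideanSpace ℝ (Fin n)) : ℝ :=
  √(1 - ‖gradient u x‖ ^ 2)

/-- The upward time-like unit normal `eₙ₊₁ = w⁻¹ (Du, 1)` of the graph. -/
def unitNormal (u : EuclideanSpace ℝ (Fin n) → ℝ) (x : EuclideanSpace ℝ (Fin n)) :
    EuclideanSpace ℝ (Fin n) × ℝ :=
  (lapse u x)⁻¹ • (gradient u x, (1 : ℝ))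

/-- The induced metric `g_ij = ⟨∂ᵢφ, ∂ⱼφ⟩`. -/
def metric (u : EuclideanSpace ℝ (Fin n) → ℝ) (x : EuclideanSpace ℝ (Fin n)) :
    Matrix (Fin n) (Fin n) ℝ :=
  Matrix.of fun i j => lorentz (partialDeriv i (position u) x) (partialDeriv j (position u) x)

/-- The second fundamental form `h_ij = ⟨∂ᵢφ, ∂ⱼeₙ₊₁⟩`. -/
def secondFundamentalForm (u : EuclideanSpace ℝ (Fin n) → ℝ) (x : EuclideanSpace ℝ (Fin n)) :
    Matrix (Fin n) (Fin n) ℝ :=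
  Matrix.of fun i j => lorentz (partialDeriv i (position u) x) (partialDeriv j (unitNormal u) x)

/-- The shape operator `A = g⁻¹ h`, with entries `h^j_i = g^{jk} h_{ki}`. -/
def shapeOperator (u : EuclideanSpace ℝ (Fin n) → ℝ) (x : EuclideanSpace ℝ (Fin n)) :
    Matrix (Fin n) (Fin n) ℝ :=
  (metric u x)⁻¹ * secondFundamentalForm u x

/-- The mean curvature `H = tr A` (the sum of the principal curvatures). -/
def meanCurvature (u : EuclideanSpace ℝ (Fin n) → ℝ) (x : EuclideanSpace ℝ (Fin n)) : ℝ :=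
  (shapeOperator u x).trace

/-- The trace-free second fundamental form `h̄^j_i = h^j_i - (H / n) δ^j_i`. -/
def traceFreeForm (u : EuclideanSpace ℝ (Fin n) → ℝ) (x : EuclideanSpace ℝ (Fin n)) :
    Matrix (Fin n) (Fin n) ℝ :=
  shapeOperator u x - (meanCurvature u x / n) • (1 : Matrix (Fin n) (Fin n) ℝ)

/-- The norm `|h̄|` with respect to the induced metric:
`|h̄|² = g^{ik} g^{jl} h̄_ij h̄_kl = h̄^j_i h̄^i_j = tr (h̄²)`. -/
def traceFreeNorm (u : EuclideanSpace ℝ (Fin n) → ℝ) (x : EuclideanSpace ℝ (Fin n)) : ℝ :=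
  √((traceFreeForm u x * traceFreeForm u x).trace)

/-! ### Domains with smooth boundary -/

/-- `ρ` is a defining function of `Ω` near `p`: it is smooth, its gradient at `p` does not vanish,
and near `p` the set `Ω` is `{ρ < 0}`. (Smoothness on the whole space is no restriction, since a
function that is smooth near `p` can be cut off away from `p`.) -/
def IsDefiningFunctionAt (Ω : Set (EuclideanSpace ℝ (Fin n))) (p : EuclideanSpace ℝ (Fin n))
    (ρ : EuclideanSpace ℝ (Fin n) → ℝ) : Prop :=
  ContDiff ℝ ∞ ρ ∧ gradient ρ p ≠ 0 ∧ ∀ᶠ x in 𝓝 p, (x ∈ Ω ↔ ρ x < 0)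

/-- `∂Ω` is a smooth hypersurface with `Ω` locally on one side of it. -/
def HasSmoothBoundary (Ω : Set (EuclideanSpace ℝ (Fin n))) : Prop :=
  ∀ p ∈ frontier Ω, ∃ ρ, IsDefiningFunctionAt Ω p ρ

open Classical in
/-- A defining function of `Ω` near the boundary point `p`. -/
def boundaryDefiningFunction (Ω : Set (EuclideanSpace ℝ (Fin n)))
    (p : EuclideanSpace ℝ (Fin n)) : EuclideanSpace ℝ (Fin n) → ℝ :=
  if h : ∃ ρ, IsDefiningFunctionAt Ω p ρ then h.choose else 0

/-- The mean curvature `H_{∂Ω} = (κ₁ + ⋯ + κₙ₋₁) / (n - 1)` of `∂Ω` at `p`, positive for balls.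
With `ν = Dρ / |Dρ|`, which on `∂Ω` near `p` is the outer unit normal, the Weingarten map of `∂Ω`
is the restriction of `dν` to the tangent space; as `⟨dν(ν), ν⟩ = 0`, its trace is `div ν`. The
value at `p ∈ ∂Ω` does not depend on the choice of `ρ`. -/
def boundaryMeanCurvature (Ω : Set (EuclideanSpace ℝ (Fin n)))
    (p : EuclideanSpace ℝ (Fin n)) : ℝ :=
  divergence (fun x => ‖gradient (boundaryDefiningFunction Ω p) x‖⁻¹ •
    gradient (boundaryDefiningFunction Ω p) x) p / ((n : ℝ) - 1)

/-- The surface measure of `∂Ω`: the `(n-1)`-dimensional Hausdorff measure, normalized so that it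
is Lebesgue measure on `(n-1)`-dimensional planes. -/
def surfaceMeasure (Ω : Set (EuclideanSpace ℝ (Fin n))) :
    Measure (EuclideanSpace ℝ (Fin n)) :=
  (μHE[n - 1] : Measure (EuclideanSpace ℝ (Fin n))).restrict (frontier Ω)

/-- The reference constant `H₀ = |∂Ω| / (n |Ω|)`. -/
def referenceCurvature (Ω : Set (EuclideanSpace ℝ (Fin n))) : ℝ :=
  (surfaceMeasure Ω).real Set.univ / (n * (volume : Measure (EuclideanSpace ℝ (Fin n))).real Ω)

end

end SpacelikeGraph

/-! Put $w=\sqrt{1-|Du|^2}$ and $X=w^{-1}Du$. The shape operator of the graph is the Jacobian $DX$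
(`shapeOperator_eq`), so $H=\operatorname{div}X$, which is the first claim, and $|\bar
h|^2=\operatorname{tr}(DX)^2-H^2/n$.

The field $Y=DX\,X-(\operatorname{div}X)X$ satisfies
$\operatorname{div}Y=\operatorname{tr}(DX)^2-(\operatorname{div}X)^2$
(`divergence_secondOrderField`), hence $$\int_\Omega|\bar h|^2=\int_{\partial\Omega}\langle
Y,\nu\rangle+\frac{n-1}{n}H^2|\Omega|.$$ Since $u$ is constant on $\partial\Omega$, there $X=a\nu$,
and $\langle Y,\nu\rangle=-a^2\operatorname{div}\nu=-(n-1)a^2H_{\partial\Omega}$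
(`HasSmoothBoundary.inner_secondOrderField`). The flux of $X$ gives
$H|\Omega|=\int_{\partial\Omega}a$, and Cauchy–Schwarz turns this into $\frac1nH^2|\Omega|\le
H_0\int_{\partial\Omega}a^2$. Together, $$\int_\Omega|\bar
h|^2\le(n-1)\int_{\partial\Omega}a^2(H_0-H_{\partial\Omega}),$$ and $a^2=w^{-2}-1\le K^2$ on
$\partial\Omega$.

The divergence theorem for the Hausdorff measure on $\partial\Omega$
(`HasSmoothBoundary.setIntegral_divergence_eq`) is proved by slicing. Near a boundary point $\Omega$
is almost a half-space; lines transverse to $\partial\Omega$ cross it at most once there, and on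
each line the fundamental theorem of calculus applies. Projecting the boundary piece to a hyperplane
distorts its measure by a factor close to 1. The resulting error is a small multiple of
$\int_{\partial\Omega}|f|$, so it adds up harmlessly over a partition of unity and can be made
arbitrarily small. -/

namespace SpacelikeGraph

/-! ### Comparable measures -/

/-- Each integral is at most $1+\delta$ times the other, so they differ by at most $\delta$ times
the smaller one. -/
theorem abs_integral_sub_le_of_nonneg {α : Type*} [MeasurableSpace α] {μ ν : Measure α}
    {δ : NNReal} (h₁ : μ ≤ (1 + δ) • ν) (h₂ : ν ≤ (1 + δ) • μ) {f : α → ℝ}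
    (hf : Integrable f ν) (h0 : ∀ x, 0 ≤ f x) :
    |∫ x, f x ∂μ - ∫ x, f x ∂ν| ≤ δ * ∫ x, f x ∂ν := by
  have hfν : Integrable f ((1 + δ) • ν) := hf.smul_measure_nnreal
  have hfμ : Integrable f μ := hfν.mono_measure h₁
  have hfμ' : Integrable f ((1 + δ) • μ) := hfμ.smul_measure_nnreal
  have e₁ : ∫ x, f x ∂μ ≤ (1 + δ) * ∫ x, f x ∂ν := by
    have := integral_mono_measure h₁ (Filter.Eventually.of_forall h0) hfν
    rwa [integral_smul_nnreal_measure, NNReal.smul_def, smul_eq_mul, NNReal.coe_add,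
      NNReal.coe_one] at this
  have e₂ : ∫ x, f x ∂ν ≤ (1 + δ) * ∫ x, f x ∂μ := by
    have := integral_mono_measure h₂ (Filter.Eventually.of_forall h0) hfμ'
    rwa [integral_smul_nnreal_measure, NNReal.smul_def, smul_eq_mul, NNReal.coe_add,
      NNReal.coe_one] at this
  have hδ := δ.coe_nonneg
  have p₁ : 0 ≤ ∫ x, f x ∂μ := integral_nonneg h0
  have p₂ : 0 ≤ ∫ x, f x ∂ν := integral_nonneg h0
  rw [abs_le]
  refine ⟨?_, by linarith⟩
  by_cases hc : ∫ x, f x ∂μ ≤ ∫ x, f x ∂ν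
  · nlinarith
  · nlinarith

/-- Integrals against two measures that bound each other up to the factor `1 + δ`. -/
theorem abs_integral_sub_le {α : Type*} [MeasurableSpace α] {μ ν : Measure α}
    {δ : NNReal} (h₁ : μ ≤ (1 + δ) • ν) (h₂ : ν ≤ (1 + δ) • μ) {f : α → ℝ}
    (hf : Integrable f ν) :
    |∫ x, f x ∂μ - ∫ x, f x ∂ν| ≤ δ * ∫ x, |f x| ∂ν := by
  have hfμ : Integrable f μ := (hf.smul_measure_nnreal (c := 1 + δ)).mono_measure h₁
  have hp := abs_integral_sub_le_of_nonneg h₁ h₂ hf.pos_part (fun x => le_max_right _ _)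
  have hn := abs_integral_sub_le_of_nonneg h₁ h₂ hf.neg_part (fun x => le_max_right _ _)
  have hsplit : ∀ x, f x = max (f x) 0 - max (-f x) 0 := fun x => by
    rcases le_total 0 (f x) with h | h <;> simp [h]
  have habs : ∀ x, |f x| = max (f x) 0 + max (-f x) 0 := fun x => by
    rcases le_total 0 (f x) with h | h <;> simp [h, abs_of_nonneg, abs_of_nonpos]
  have eν : ∫ x, f x ∂ν = ∫ x, max (f x) 0 ∂ν - ∫ x, max (-f x) 0 ∂ν := by
    rw [← integral_sub hf.pos_part hf.neg_part]; exact integral_congr_ae (ae_of_all _ hsplit)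
  have eμ : ∫ x, f x ∂μ = ∫ x, max (f x) 0 ∂μ - ∫ x, max (-f x) 0 ∂μ := by
    rw [← integral_sub hfμ.pos_part hfμ.neg_part]; exact integral_congr_ae (ae_of_all _ hsplit)
  have ea : ∫ x, |f x| ∂ν = ∫ x, max (f x) 0 ∂ν + ∫ x, max (-f x) 0 ∂ν := by
    rw [← integral_add hf.pos_part hf.neg_part]; exact integral_congr_ae (ae_of_all _ habs)
  rw [eν, eμ, ea]
  rw [abs_le] at hp hn ⊢
  constructor <;> linarith [hp.1, hp.2, hn.1, hn.2]

/-! ### Slicing by parallel lines -/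

section Slicing

variable {E : Type*} [NormedAddCommGroup E] [InnerProductSpace ℝ E] [FiniteDimensional ℝ E]
  [MeasurableSpace E] [BorelSpace E]

theorem integral_eq_integral_integral_orthogonal {e : E} (he : ‖e‖ = 1) {g : E → ℝ}
    (hg : Integrable g) :
    ∫ x, g x = ∫ y : (ℝ ∙ e)ᗮ, ∫ s : ℝ, g ((y : E) + s • e) := by
  have hV : (μHE[Module.finrank ℝ E] : Measure E) = volume :=
    InnerProductSpace.euclideanHausdorffMeasure_eq_volume
  have h1 := (ℝ ∙ e).measurePreserving_measurableEquivProd (0 : E)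
  rw [hV] at h1
  have h2 : MeasurePreserving
      (MeasurableEquiv.prodCongr (LinearIsometryEquiv.toSpanUnitSingleton (𝕜 := ℝ) e he).toMeasurableEquiv
        (MeasurableEquiv.refl ((ℝ ∙ e)ᗮ))) :=
    (LinearIsometryEquiv.toSpanUnitSingleton (𝕜 := ℝ) e he).measurePreserving.prod
      (MeasurePreserving.id (volume : Measure (ℝ ∙ e)ᗮ))
  have h3 := h2.trans (h1.symm)
  have hk : ∀ z : ℝ × (ℝ ∙ e)ᗮ,
      ((MeasurableEquiv.prodCongr
        (LinearIsometryEquiv.toSpanUnitSingleton (𝕜 := ℝ) e he).toMeasurableEquiv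
        (MeasurableEquiv.refl ((ℝ ∙ e)ᗮ))).trans ((ℝ ∙ e).measurableEquivProd (0 : E)).symm) z
        = (z.2 : E) + z.1 • e := by
    intro z
    rw [MeasurableEquiv.trans_apply, Submodule.measurableEquivProd_symm_apply]
    change (z.1 • e + (z.2 : E)) + 0 = _
    rw [add_zero, add_comm]
  have h4 : Integrable (fun z : ℝ × (ℝ ∙ e)ᗮ => g ((z.2 : E) + z.1 • e)) := by
    have := (h3.integrable_comp_emb (MeasurableEquiv.measurableEmbedding _)).2 hg
    simpa only [Function.comp_def, hk] using this
  rw [← h3.integral_comp' g, Measure.volume_eq_prod, ← integral_prod_symm _ h4]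
  exact integral_congr_ae (ae_of_all _ fun z => congrArg g (hk z))

/-- The volume integral as an integral over lines of direction `v`, which are parametrized by the
hyperplane orthogonal to the unit vector `e`. -/
theorem integral_eq_integral_integral_lines {e v : E} (he : ‖e‖ = 1) (hv : 0 < inner ℝ e v)
    {g : E → ℝ} (hg : Integrable g) :
    ∫ x, g x = inner ℝ e v * ∫ y : (ℝ ∙ e)ᗮ, ∫ s : ℝ, g ((y : E) + s • v) := by
  -- This shear fixes $e^\perp$ and sends $e$ to $v$; its determinant $1+\langle
  -- e,v-e\rangle=\langle e,v\rangle$ is the Jacobian factor.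
  set L : E →ₗ[ℝ] E := LinearMap.transvection (innerₛₗ ℝ e) (v - e) with hL
  have hee : inner ℝ e e = (1 : ℝ) := by rw [real_inner_self_eq_norm_sq, he]; norm_num
  have hdet : L.det = inner ℝ e v := by
    rw [hL, LinearMap.transvection.det]
    simp [inner_sub_right, he]
  have hdet0 : L.det ≠ 0 := by rw [hdet]; exact hv.ne'
  have hLx : ∀ (y : (ℝ ∙ e)ᗮ) (s : ℝ), L ((y : E) + s • e) = y + s • v := by
    intro y s
    have hy : inner ℝ e (y : E) = 0 := Submodule.mem_orthogonal_singleton_iff_inner_right.1 y.2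
    simp only [hL, LinearMap.transvection.apply, innerₛₗ_apply_apply, inner_add_right, hy, inner_smul_right,
      hee, smul_sub]
    simp
  have hemb : MeasurableEmbedding L :=
    (LinearMap.equivOfDetNeZero L hdet0).toContinuousLinearEquiv.toHomeomorph.measurableEmbedding
  have hmap := Measure.map_linearMap_addHaar_eq_smul_addHaar (volume : Measure E) hdet0
  have hgL : Integrable (fun x => g (L x)) := by
    have : Integrable g (Measure.map L volume) := by
      rw [hmap]; exact hg.smul_measure ENNReal.ofReal_ne_top
    exact (hemb.integrable_map_iff).1 this
  have := integral_eq_integral_integral_orthogonal he hgL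
  simp only [hLx] at this
  rw [← this, ← hemb.integral_map, hmap, integral_smul_measure, hdet, abs_inv, abs_of_pos hv,
    ENNReal.toReal_ofReal (by positivity), smul_eq_mul, mul_inv_cancel_left₀ hv.ne']

end Slicing

/-! ### Euclidean Hausdorff measure of Lipschitz images -/

section Lipschitz

variable {E F : Type*} [EMetricSpace E] [MeasurableSpace E] [BorelSpace E]
  [EMetricSpace F] [MeasurableSpace F] [BorelSpace F]

theorem euclideanHausdorffMeasure_image_le {k : NNReal} {f : E → F} {s : Set E}
    (hf : LipschitzOnWith k f s) (d : ℕ) : μHE[d] (f '' s) ≤ (k : ℝ≥0∞) ^ d * μHE[d] s := by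
  have := hf.hausdorffMeasure_image_le (d := d) (Nat.cast_nonneg d)
  rw [ENNReal.rpow_natCast] at this
  simp only [Measure.euclideanHausdorffMeasure_def, Measure.smul_apply]
  rw [mul_smul_comm]
  gcongr

end Lipschitz

/-- Change of variables under a map `π` that is bi-Lipschitz on `T`, up to the factor by which
`π` distorts the measure. -/
theorem abs_integral_sub_setIntegral_le {E F : Type*} [MetricSpace E] [MeasurableSpace E]
    [BorelSpace E] [PolishSpace E] [MetricSpace F] [MeasurableSpace F] [BorelSpace F]
    {d : ℕ} {T : Set E} (hT : MeasurableSet T) {π : E → F} {k δ : NNReal} (hk : k ^ d ≤ 1 + δ)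
    (h₁ : ∀ x ∈ T, ∀ y ∈ T, dist (π x) (π y) ≤ k * dist x y)
    (h₂ : ∀ x ∈ T, ∀ y ∈ T, dist x y ≤ k * dist (π x) (π y))
    {f : E → ℝ} {G : F → ℝ} (hG : ∀ x ∈ T, G (π x) = f x) (hG0 : ∀ y, y ∉ π '' T → G y = 0)
    (hf : IntegrableOn f T μHE[d]) :
    |∫ y, G y ∂μHE[d] - ∫ x in T, f x ∂μHE[d]| ≤ δ * ∫ x in T, |f x| ∂μHE[d] := by
  have hL₁ : LipschitzOnWith k π T := LipschitzOnWith.of_dist_le_mul h₁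
  have hinj : Set.InjOn π T := fun x hx y hy hxy => by
    have := h₂ x hx y hy
    rw [hxy, dist_self, mul_zero] at this
    exact dist_le_zero.1 this
  rcases T.eq_empty_or_nonempty with rfl | ⟨x₀, hx₀⟩
  · have : G = fun _ => 0 := funext fun y => hG0 y (by simp)
    simp [this]
  have : Nonempty E := ⟨x₀⟩
  have hval : MeasurableEmbedding (Subtype.val : T → E) := MeasurableEmbedding.subtype_coe hT
  have hπ : MeasurableEmbedding (T.domRestrict π) :=
    hL₁.continuousOn.measurableEmbedding hT hinj
  have himg : ∀ B : Set T, T.domRestrict π '' B = π '' (Subtype.val '' B) := fun B => by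
    rw [Set.image_image]; rfl
  have hsub : ∀ B : Set T, Subtype.val '' B ⊆ T := fun B => Subtype.coe_image_subset T B
  have hk' : (k : ℝ≥0∞) ^ d ≤ ((1 + δ : NNReal) : ℝ≥0∞) := by exact_mod_cast hk
  -- Both measures are pulled back to `T`. There `π` and its inverse are `k`-Lipschitz, so each
  -- measure is at most $k^d\le1+\delta$ times the other.
  have c₁ : Measure.comap (T.domRestrict π) μHE[d] ≤
      (1 + δ) • Measure.comap (Subtype.val : T → E) μHE[d] := by
    refine Measure.le_iff.2 fun B _ => ?_
    rw [Measure.smul_apply, hπ.comap_apply, hval.comap_apply, himg, ENNReal.smul_def, smul_eq_mul]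
    exact (euclideanHausdorffMeasure_image_le (hL₁.mono (hsub B)) d).trans (by gcongr)
  have c₂ : Measure.comap (Subtype.val : T → E) μHE[d] ≤
      (1 + δ) • Measure.comap (T.domRestrict π) μHE[d] := by
    refine Measure.le_iff.2 fun B _ => ?_
    rw [Measure.smul_apply, hπ.comap_apply, hval.comap_apply, himg, ENNReal.smul_def, smul_eq_mul]
    have hinv : ∀ x ∈ T, Function.invFunOn π T (π x) = x := fun x hx =>
      hinj.leftInvOn_invFunOn hx
    have hΦ : LipschitzOnWith k (Function.invFunOn π T) (π '' (Subtype.val '' B)) := by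
      refine LipschitzOnWith.of_dist_le_mul ?_
      rintro _ ⟨x, hx, rfl⟩ _ ⟨y, hy, rfl⟩
      rw [hinv x (hsub B hx), hinv y (hsub B hy)]
      exact h₂ x (hsub B hx) y (hsub B hy)
    have hBB : Function.invFunOn π T '' (π '' (Subtype.val '' B)) = Subtype.val '' B := by
      rw [Set.image_image]
      exact (Set.image_congr fun x hx => hinv x (hsub B hx)).trans (Set.image_id' _)
    calc μHE[d] (Subtype.val '' B)
        = μHE[d] (Function.invFunOn π T '' (π '' (Subtype.val '' B))) := by rw [hBB]
      _ ≤ _ := (euclideanHausdorffMeasure_image_le hΦ d).trans (by gcongr)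
  have i₁ : ∫ y, G y ∂μHE[d] = ∫ x : T, f x ∂Measure.comap (T.domRestrict π) μHE[d] := by
    have hr : Set.range (T.domRestrict π) = π '' T := Set.range_domRestrict π T
    rw [← setIntegral_eq_integral_of_forall_compl_eq_zero (s := π '' T) (fun y hy => hG0 y hy),
      ← hr, ← hπ.map_comap, hπ.integral_map]
    exact integral_congr_ae (ae_of_all _ fun x => hG x x.2)
  rw [i₁, ← integral_subtype_comap hT f, ← integral_subtype_comap hT (fun x => |f x|)]
  exact abs_integral_sub_le c₁ c₂ ((integrableOn_iff_comap_subtypeVal hT).1 hf)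

/-! ### Domains close to a half-space -/

section Local

variable {E : Type*} [NormedAddCommGroup E] [InnerProductSpace ℝ E]

/-- The projection along `v` onto the hyperplane orthogonal to `e`. -/
noncomputable def obliqueProjection (e v : E) : E →L[ℝ] (ℝ ∙ e)ᗮ :=
  (ℝ ∙ e)ᗮ.orthogonalProjectionOnto ∘L
    (ContinuousLinearMap.id ℝ E - ((inner ℝ e v)⁻¹ • innerSL ℝ e).smulRight v)

theorem coe_obliqueProjection {e v : E} (hv : inner ℝ e v ≠ (0 : ℝ)) (x : E) :
    (obliqueProjection e v x : E) = x - ((inner ℝ e v)⁻¹ * inner ℝ e x) • v := by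
  have hmem : x - ((inner ℝ e v)⁻¹ * inner ℝ e x) • v ∈ (ℝ ∙ e)ᗮ := by
    rw [Submodule.mem_orthogonal_singleton_iff_inner_right, inner_sub_right, inner_smul_right]
    field_simp
    ring
  have : obliqueProjection e v x = (ℝ ∙ e)ᗮ.orthogonalProjectionOnto
      (x - ((inner ℝ e v)⁻¹ * inner ℝ e x) • v) := by
    simp [obliqueProjection]
  rw [this]
  exact congrArg Subtype.val
    (Submodule.orthogonalProjectionOnto_mem_subspace_eq_self (⟨_, hmem⟩ : (ℝ ∙ e)ᗮ))

theorem obliqueProjection_add_smul {e v : E} (hv : inner ℝ e v ≠ (0 : ℝ)) (y : (ℝ ∙ e)ᗮ) (s : ℝ) :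
    obliqueProjection e v ((y : E) + s • v) = y := by
  have hy : inner ℝ e (y : E) = 0 := Submodule.mem_orthogonal_singleton_iff_inner_right.1 y.2
  apply Subtype.ext
  rw [coe_obliqueProjection hv, inner_add_right, hy, inner_smul_right]
  have : (inner ℝ e v)⁻¹ * (0 + s * inner ℝ e v) = s := by field_simp; ring
  rw [this, add_sub_cancel_right]

/-- The projection moves $z$ by at most $3\varepsilon\|z\|$, and
$(1+6\varepsilon)(1-3\varepsilon)=1+18\varepsilon(\frac16-\varepsilon)\ge1$; this is where the
constants 6 and 1/6 come from. -/
theorem obliqueProjection_bounds {e v : E} (hv : 1 ≤ inner ℝ e v) (hv3 : ‖v‖ ≤ 3) {ε : ℝ}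
    (hε0 : 0 ≤ ε) (hε : ε ≤ 1 / 6) {z : E} (hz : |inner ℝ e z| ≤ ε * ‖z‖) :
    ‖obliqueProjection e v z‖ ≤ (1 + 6 * ε) * ‖z‖ ∧
      ‖z‖ ≤ (1 + 6 * ε) * ‖obliqueProjection e v z‖ := by
  have hv0 : inner ℝ e v ≠ (0 : ℝ) := by linarith
  have hc : ‖((inner ℝ e v)⁻¹ * inner ℝ e z) • v‖ ≤ 3 * ε * ‖z‖ := by
    rw [norm_smul, norm_mul, norm_inv, Real.norm_eq_abs, Real.norm_eq_abs,
      abs_of_pos (by linarith : (0 : ℝ) < inner ℝ e v)]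
    have h1 : (inner ℝ e v)⁻¹ ≤ (1 : ℝ) := inv_le_one_of_one_le₀ hv
    have h2 : (inner ℝ e v)⁻¹ * |inner ℝ e z| ≤ 1 * (ε * ‖z‖) :=
      mul_le_mul h1 hz (abs_nonneg _) zero_le_one
    calc _ ≤ (1 * (ε * ‖z‖)) * 3 := mul_le_mul h2 hv3 (norm_nonneg _) (by positivity)
      _ = _ := by ring
  have e1 : ‖obliqueProjection e v z‖ = ‖z - ((inner ℝ e v)⁻¹ * inner ℝ e z) • v‖ := by
    rw [← coe_obliqueProjection hv0, Submodule.coe_norm]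
  rw [e1]
  have h3 := norm_sub_le z (((inner ℝ e v)⁻¹ * inner ℝ e z) • v)
  have h4 := norm_sub_norm_le z (((inner ℝ e v)⁻¹ * inner ℝ e z) • v)
  have h5 := norm_nonneg z
  constructor
  · nlinarith
  · have h6 : (1 - 3 * ε) * ‖z‖ ≤ ‖z - ((inner ℝ e v)⁻¹ * inner ℝ e z) • v‖ := by linarith
    have h7 : ‖z‖ ≤ (1 + 6 * ε) * ((1 - 3 * ε) * ‖z‖) := by
      have : 0 ≤ ε * (1 / 6 - ε) * ‖z‖ := by
        have : 0 ≤ 1 / 6 - ε := by linarith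
        positivity
      nlinarith
    exact h7.trans (mul_le_mul_of_nonneg_left h6 (by positivity))

/-- `P` will be the trace of `Ω` on a line. It is known to be a half-line only inside a ball
containing the support of `h`, hence the restriction to points where the derivative is nonzero. -/
theorem integral_indicator_deriv_of_iff {h : ℝ → ℝ} (hc : ContDiff ℝ 1 h)
    (hs : HasCompactSupport h) {P : Set ℝ} {s₀ : ℝ}
    (hP : ∀ s, deriv h s ≠ 0 → (s ∈ P ↔ s < s₀)) :
    ∫ s, P.indicator (deriv h) s = h s₀ := by
  have : P.indicator (deriv h) = (Set.Iio s₀).indicator (deriv h) := by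
    ext s
    by_cases h0 : deriv h s = 0
    · rw [Set.indicator_apply_eq_zero.2 fun _ => h0, Set.indicator_apply_eq_zero.2 fun _ => h0]
    · by_cases hs : s < s₀
      · rw [Set.indicator_of_mem ((hP s h0).2 hs), Set.indicator_of_mem (Set.mem_Iio.2 hs)]
      · rw [Set.indicator_of_notMem fun h' => hs ((hP s h0).1 h'),
          Set.indicator_of_notMem fun h' => hs (Set.mem_Iio.1 h')]
  rw [this, integral_indicator measurableSet_Iio, ← integral_Iic_eq_integral_Iio,
    hs.integral_Iic_deriv_eq hc]

theorem integral_deriv_eq_zero {h : ℝ → ℝ} (hc : ContDiff ℝ 1 h) (hs : HasCompactSupport h) :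
    ∫ s, deriv h s = 0 := by
  have hi : Integrable (deriv h) :=
    (hc.continuous_deriv le_rfl).integrable_of_hasCompactSupport hs.deriv
  rw [← intervalIntegral.integral_Iic_add_Ioi (b := 0) hi.integrableOn hi.integrableOn,
    hs.integral_Iic_deriv_eq hc, hs.integral_Ioi_deriv_eq hc]
  ring

/-- `Ω` is, in the ball `B(p, r)`, the sublevel set of a function that is there close to the
linear function `a ⟨e, ·⟩`. -/
structure IsNearlyHalfSpace (Ω : Set E) (p : E) (r : ℝ) (e : E) (ρ : E → ℝ) (a ε : ℝ) :
    Prop where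
  norm_eq : ‖e‖ = 1
  pos : 0 < a
  nonneg : 0 ≤ ε
  le : ε ≤ 1 / 6
  mem_iff : ∀ x ∈ Metric.ball p r, x ∈ Ω ↔ ρ x < 0
  eq_zero : ∀ x ∈ Metric.ball p r, x ∈ frontier Ω → ρ x = 0
  approx : ∀ x ∈ Metric.ball p r, ∀ y ∈ Metric.ball p r,
    |ρ x - ρ y - a * inner ℝ e (x - y)| ≤ a * ε * ‖x - y‖

namespace IsNearlyHalfSpace

variable {Ω : Set E} {p : E} {r : ℝ} {e : E} {ρ : E → ℝ} {a ε : ℝ}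

theorem abs_inner_le (H : IsNearlyHalfSpace Ω p r e ρ a ε) {x y : E}
    (hx : x ∈ frontier Ω ∩ Metric.ball p r) (hy : y ∈ frontier Ω ∩ Metric.ball p r) :
    |inner ℝ e (x - y)| ≤ ε * ‖x - y‖ := by
  have := H.approx x hx.2 y hy.2
  rw [H.eq_zero x hx.2 hx.1, H.eq_zero y hy.2 hy.1, sub_zero, zero_sub, abs_neg, abs_mul,
    abs_of_pos H.pos, mul_assoc] at this
  exact le_of_mul_le_mul_left this H.pos

/-- On the line, $\rho$ equals $as\langle e,v\rangle$ up to an error $a\varepsilon|s|\|v\|\le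
a|s|/2$, and $\langle e,v\rangle\ge1$, so its sign is that of $s$. In particular the line crosses
the boundary at most once in the ball. -/
theorem mem_iff_lt (H : IsNearlyHalfSpace Ω p r e ρ a ε) {v : E} (hv : 1 ≤ inner ℝ e v)
    (hv3 : ‖v‖ ≤ 3) {q : E} (hq : q ∈ frontier Ω ∩ Metric.ball p r) {s : ℝ}
    (hs : q + s • v ∈ Metric.ball p r) : q + s • v ∈ Ω ↔ s < 0 := by
  rw [H.mem_iff _ hs]
  have h := H.approx _ hs q hq.2
  rw [H.eq_zero q hq.2 hq.1, sub_zero, add_sub_cancel_left, inner_smul_right, norm_smul,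
    Real.norm_eq_abs, abs_le] at h
  have ha := H.pos
  have hb : a * ε * (|s| * ‖v‖) ≤ a * |s| * (1 / 2) := by
    have : ε * ‖v‖ ≤ 1 / 6 * 3 := mul_le_mul H.le hv3 (norm_nonneg _) (by norm_num)
    have h2 : a * |s| * (ε * ‖v‖) ≤ a * |s| * (1 / 2) :=
      mul_le_mul_of_nonneg_left (by linarith) (by positivity)
    linarith
  constructor
  · intro hneg
    by_contra! hs0
    rw [abs_of_nonneg hs0] at h hb
    have : a * s * 1 ≤ a * s * inner ℝ e v := mul_le_mul_of_nonneg_left hv (by positivity)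
    have h3 : 0 ≤ a * s := by positivity
    linarith [h.1]
  · intro hneg
    rw [abs_of_neg hneg] at h hb
    have h3 : 0 < a * -s := mul_pos ha (by linarith)
    have : a * -s * 1 ≤ a * -s * inner ℝ e v := mul_le_mul_of_nonneg_left hv h3.le
    linarith [h.2]

theorem integral_line_eq (H : IsNearlyHalfSpace Ω p r e ρ a ε) (hΩ : IsOpen Ω) {v : E} (hv : 1 ≤ inner ℝ e v)
    (hv3 : ‖v‖ ≤ 3) {f : E → ℝ} (hf : ContDiff ℝ 1 f) (hfs : tsupport f ⊆ Metric.ball p r)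
    (y : E) :
    (∀ s₀ : ℝ, y + s₀ • v ∈ frontier Ω ∩ Metric.ball p r →
      ∫ s : ℝ, Ω.indicator (fun x => fderiv ℝ f x v) (y + s • v) = f (y + s₀ • v)) ∧
    ((∀ s : ℝ, y + s • v ∉ frontier Ω ∩ Metric.ball p r) →
      ∫ s : ℝ, Ω.indicator (fun x => fderiv ℝ f x v) (y + s • v) = 0) := by
  set h : ℝ → ℝ := fun s => f (y + s • v) with hh
  have hline : ContDiff ℝ 1 (fun s : ℝ => y + s • v) := by fun_prop
  have hc : ContDiff ℝ 1 h := hf.comp hline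
  have hd : ∀ s, deriv h s = fderiv ℝ f (y + s • v) v := by
    intro s
    have h1 : HasDerivAt (fun s : ℝ => y + s • v) v s := by
      simpa using ((hasDerivAt_id s).smul_const v).const_add y
    exact ((hf.differentiable one_ne_zero _).hasFDerivAt.comp_hasDerivAt s h1).deriv
  have hv1 : 1 ≤ ‖v‖ := by
    have := real_inner_le_norm e v
    rw [H.norm_eq, one_mul] at this
    linarith
  have hs : HasCompactSupport h := by
    refine HasCompactSupport.intro (K := Set.Icc (-(r + ‖p‖ + ‖y‖)) (r + ‖p‖ + ‖y‖))
      isCompact_Icc fun s hs => ?_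
    by_contra h0
    have hmem : y + s • v ∈ Metric.ball p r := hfs (subset_tsupport f h0)
    rw [mem_ball_iff_norm] at hmem
    have h1 : ‖s • v‖ ≤ ‖y + s • v - p‖ + ‖p‖ + ‖y‖ := by
      calc ‖s • v‖ = ‖(y + s • v - p) + p - y‖ := by congr 1; abel
        _ ≤ _ := (norm_sub_le _ _).trans (by gcongr; exact norm_add_le _ _)
    rw [norm_smul, Real.norm_eq_abs] at h1
    have h2 : |s| * 1 ≤ |s| * ‖v‖ := mul_le_mul_of_nonneg_left hv1 (abs_nonneg _)
    exact hs (abs_le.1 (by linarith))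
  have hsupp : ∀ s, deriv h s ≠ 0 → y + s • v ∈ Metric.ball p r := by
    intro s h0
    rw [hd] at h0
    refine hfs (support_fderiv_subset ℝ (f := f) fun h' => h0 ?_)
    rw [h']; rfl
  have hint : ∀ s, Ω.indicator (fun x => fderiv ℝ f x v) (y + s • v) =
      ((fun s : ℝ => y + s • v) ⁻¹' Ω).indicator (deriv h) s := by
    intro s
    by_cases hs : y + s • v ∈ Ω
    · have hs' : s ∈ (fun s : ℝ => y + s • v) ⁻¹' Ω := hs
      rw [Set.indicator_of_mem hs, Set.indicator_of_mem hs', hd]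
    · have hs' : s ∉ (fun s : ℝ => y + s • v) ⁻¹' Ω := hs
      rw [Set.indicator_of_notMem hs, Set.indicator_of_notMem hs']
  simp only [hint]
  constructor
  · intro s₀ hs₀
    refine integral_indicator_deriv_of_iff hc hs fun s h0 => ?_
    have hmem := hsupp s h0
    have heq : y + s • v = (y + s₀ • v) + (s - s₀) • v := by rw [sub_smul]; abel
    have := H.mem_iff_lt hv hv3 hs₀ (s := s - s₀) (heq ▸ hmem)
    rw [← heq] at this
    rw [Set.mem_preimage, this, sub_neg]
  · intro hno
    -- The part of the line in the ball is connected. As it misses the frontier, it lies entirely in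
    -- `Ω` or entirely outside; in both cases the integral vanishes.
    have hconv : IsPreconnected ((fun s : ℝ => y + s • v) ⁻¹' Metric.ball p r) := by
      have : (fun s : ℝ => y + s • v) = AffineMap.lineMap y (y + v) := by
        ext s; simp [AffineMap.lineMap_apply, add_comm]
      rw [this]
      exact ((convex_ball p r).affine_preimage _).isPreconnected
    have himg := hconv.image _ (hline.continuous.continuousOn)
    by_cases hP : ∃ s : ℝ, y + s • v ∈ Metric.ball p r ∧ y + s • v ∈ Ω
    · obtain ⟨s₁, hs₁, hs₁'⟩ := hP
      have : ∀ s, ((fun s : ℝ => y + s • v) ⁻¹' Ω).indicator (deriv h) s = deriv h s := by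
        intro s
        by_cases h0 : deriv h s = 0
        · rw [Set.indicator_apply_eq_zero.2 fun _ => h0, h0]
        have hmem := hsupp s h0
        refine Set.indicator_of_mem ?_ _
        have hmem' : ∀ t, y + t • v ∈ Metric.ball p r → y + t • v ∈
            (fun s : ℝ => y + s • v) '' ((fun s : ℝ => y + s • v) ⁻¹' Metric.ball p r) :=
          fun t ht => ⟨t, ht, rfl⟩
        refine himg.subset_left_of_subset_union hΩ isClosed_closure.isOpen_compl
          (Set.disjoint_compl_right_iff_subset.2 subset_closure) ?_
          ⟨_, hmem' s₁ hs₁, hs₁'⟩ (hmem' s hmem)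
        rintro _ ⟨t, ht, rfl⟩
        by_contra hcon
        rw [Set.mem_union, not_or, Set.notMem_compl_iff] at hcon
        have hfr : y + t • v ∈ frontier Ω := by
          rw [hΩ.frontier_eq]
          exact ⟨hcon.2, hcon.1⟩
        exact hno t (Set.mem_inter hfr ht)
      simp only [this]
      exact integral_deriv_eq_zero hc hs
    · push Not at hP
      have : ∀ s, ((fun s : ℝ => y + s • v) ⁻¹' Ω).indicator (deriv h) s = 0 := by
        intro s
        by_cases h0 : deriv h s = 0
        · exact Set.indicator_apply_eq_zero.2 fun _ => h0
        exact Set.indicator_of_notMem (s := (fun s : ℝ => y + s • v) ⁻¹' Ω) (hP s (hsupp s h0)) _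
      simp [this]

theorem dist_obliqueProjection_le (H : IsNearlyHalfSpace Ω p r e ρ a ε) {v : E}
    (hv : 1 ≤ inner ℝ e v) (hv3 : ‖v‖ ≤ 3) {x y : E}
    (hx : x ∈ frontier Ω ∩ Metric.ball p r) (hy : y ∈ frontier Ω ∩ Metric.ball p r) :
    dist (obliqueProjection e v x) (obliqueProjection e v y) ≤ (1 + 6 * ε) * dist x y ∧
      dist x y ≤ (1 + 6 * ε) * dist (obliqueProjection e v x) (obliqueProjection e v y) := by
  simp only [dist_eq_norm, ← map_sub]
  exact obliqueProjection_bounds hv hv3 H.nonneg H.le (H.abs_inner_le hx hy)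

theorem finrank_orthogonal {d : ℕ} [Fact (Module.finrank ℝ E = d + 1)]
    (H : IsNearlyHalfSpace Ω p r e ρ a ε) :
    Module.finrank ℝ (ℝ ∙ e)ᗮ = d :=
  Submodule.finrank_orthogonal_span_singleton fun h => by
    have := H.norm_eq
    rw [h, norm_zero] at this
    exact zero_ne_one this

variable [FiniteDimensional ℝ E] [MeasurableSpace E] [BorelSpace E] {d : ℕ}
  [Fact (Module.finrank ℝ E = d + 1)]

/-- The orthogonal projection to $e^\perp$ (the case `v = e`) has a Lipschitz inverse on the
boundary piece, which is thus a Lipschitz image of a bounded set in a `d`-dimensional space. -/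
theorem euclideanHausdorffMeasure_lt_top (H : IsNearlyHalfSpace Ω p r e ρ a ε) :
    μHE[d] (frontier Ω ∩ Metric.ball p r) < ⊤ := by
  have hee : inner ℝ e e = (1 : ℝ) := by rw [real_inner_self_eq_norm_sq, H.norm_eq]; norm_num
  have hε := H.nonneg
  have hb := fun x (hx : x ∈ frontier Ω ∩ Metric.ball p r) y
    (hy : y ∈ frontier Ω ∩ Metric.ball p r) =>
      (H.dist_obliqueProjection_le (v := e) hee.ge (by rw [H.norm_eq]; norm_num) hx hy).2
  set T := frontier Ω ∩ Metric.ball p r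
  set π := obliqueProjection e e
  have hinj : Set.InjOn π T := fun x hx y hy hxy => by
    have := hb x hx y hy
    rw [hxy, dist_self, mul_zero] at this
    exact dist_le_zero.1 this
  have hL : LipschitzOnWith (1 + 6 * ε).toNNReal (Function.invFunOn π T) (π '' T) := by
    refine LipschitzOnWith.of_dist_le_mul ?_
    rintro _ ⟨x, hx, rfl⟩ _ ⟨y, hy, rfl⟩
    rw [hinj.leftInvOn_invFunOn hx, hinj.leftInvOn_invFunOn hy,
      Real.coe_toNNReal _ (by positivity)]
    exact hb x hx y hy
  have hTT : Function.invFunOn π T '' (π '' T) = T := by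
    rw [Set.image_image]
    exact (Set.image_congr fun x hx => hinj.leftInvOn_invFunOn hx).trans (Set.image_id' _)
  have hbd : Bornology.IsBounded (π '' T) :=
    π.lipschitz.isBounded_image (Metric.isBounded_ball.subset Set.inter_subset_right)
  have hvol : (μHE[d] : Measure (ℝ ∙ e)ᗮ) = volume := by
    have := InnerProductSpace.euclideanHausdorffMeasure_eq_volume (V := (ℝ ∙ e)ᗮ)
    rwa [H.finrank_orthogonal (d := d)] at this
  calc μHE[d] T = μHE[d] (Function.invFunOn π T '' (π '' T)) := by rw [hTT]
    _ ≤ _ := euclideanHausdorffMeasure_image_le hL d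
    _ < ⊤ := by
      rw [hvol]
      exact ENNReal.mul_lt_top (ENNReal.pow_lt_top ENNReal.coe_lt_top) hbd.measure_lt_top

/-- Slicing along `v` reduces the volume integral exactly to an integral over $e^\perp$ of the
values of `f` at the crossing points. The only error is the distortion of surface measure by the
oblique projection, at most $(1+6\varepsilon)^d$. -/
theorem abs_setIntegral_fderiv_sub_le (H : IsNearlyHalfSpace Ω p r e ρ a ε) (hΩ : IsOpen Ω)
    {v : E} (hv : 1 ≤ inner ℝ e v) (hv3 : ‖v‖ ≤ 3) {δ : NNReal} (hδ : (1 + 6 * ε) ^ d ≤ 1 + δ)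
    {f : E → ℝ} (hf : ContDiff ℝ 1 f) (hfs : tsupport f ⊆ Metric.ball p r)
    (hfi : IntegrableOn f (frontier Ω) μHE[d]) :
    |(∫ x in Ω, fderiv ℝ f x v) - inner ℝ e v * ∫ x in frontier Ω, f x ∂μHE[d]| ≤
      inner ℝ e v * (δ * ∫ x in frontier Ω, |f x| ∂μHE[d]) := by
  have hε := H.nonneg
  have hv0 : inner ℝ e v ≠ (0 : ℝ) := by linarith
  have hvol : (μHE[d] : Measure (ℝ ∙ e)ᗮ) = volume := by
    have := InnerProductSpace.euclideanHausdorffMeasure_eq_volume (V := (ℝ ∙ e)ᗮ)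
    rwa [H.finrank_orthogonal (d := d)] at this
  have hfc : HasCompactSupport f :=
    (Metric.isBounded_ball.subset hfs).isCompact_closure.of_isClosed_subset
      (isClosed_tsupport f) subset_closure
  set T := frontier Ω ∩ Metric.ball p r with hT
  have hTm : MeasurableSet T := isClosed_frontier.measurableSet.inter measurableSet_ball
  have hint : Integrable (Ω.indicator fun x => fderiv ℝ f x v) := by
    refine Integrable.indicator ?_ hΩ.measurableSet
    refine Continuous.integrable_of_hasCompactSupport
      ((hf.continuous_fderiv one_ne_zero).clm_apply continuous_const) ?_
    exact hfc.fderiv_apply (𝕜 := ℝ) v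
  have hrest : ∀ g : E → ℝ, (∀ x, f x = 0 → g x = 0) →
      ∫ x in frontier Ω, g x ∂μHE[d] = ∫ x in T, g x ∂μHE[d] := by
    intro g hg
    refine setIntegral_eq_of_subset_of_forall_sdiff_eq_zero isClosed_frontier.measurableSet
      Set.inter_subset_left fun x hx => hg x ?_
    by_contra h0
    exact hx.2 ⟨hx.1, hfs (subset_tsupport f h0)⟩
  rw [hrest f fun x hx => hx, hrest (fun x => |f x|) fun x hx => by simp [hx],
    ← integral_indicator hΩ.measurableSet,
    integral_eq_integral_integral_lines H.norm_eq (by linarith) hint, ← mul_sub, abs_mul,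
    abs_of_pos (by linarith : (0 : ℝ) < inner ℝ e v)]
  refine mul_le_mul_of_nonneg_left ?_ (by linarith)
  rw [← hvol]
  have hk : ((1 + 6 * ε).toNNReal : ℝ) = 1 + 6 * ε := Real.coe_toNNReal _ (by positivity)
  refine abs_integral_sub_setIntegral_le hTm (π := obliqueProjection e v)
    (k := (1 + 6 * ε).toNNReal) ?_ ?_ ?_ ?_ ?_ (hfi.mono_set Set.inter_subset_left)
  · rw [← NNReal.coe_le_coe]
    push_cast
    rwa [hk]
  · intro x hx y hy
    rw [hk]
    exact (H.dist_obliqueProjection_le hv hv3 hx hy).1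
  · intro x hx y hy
    rw [hk]
    exact (H.dist_obliqueProjection_le hv hv3 hx hy).2
  · intro x hx
    have hxx : (obliqueProjection e v x : E) + ((inner ℝ e v)⁻¹ * inner ℝ e x) • v = x := by
      rw [coe_obliqueProjection hv0, sub_add_cancel]
    have := (H.integral_line_eq hΩ hv hv3 hf hfs (obliqueProjection e v x : E)).1
      ((inner ℝ e v)⁻¹ * inner ℝ e x) (by rwa [hxx])
    rwa [hxx] at this
  · intro y hy
    refine (H.integral_line_eq hΩ hv hv3 hf hfs (y : E)).2 fun s hs => hy ?_
    exact ⟨_, hs, obliqueProjection_add_smul hv0 y s⟩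

end IsNearlyHalfSpace

end Local

/-! ### The outward unit normal -/

section Normal

variable {n : ℕ} {Ω : Set (EuclideanSpace ℝ (Fin n))} {p : EuclideanSpace ℝ (Fin n)}
  {ρ ρ' : EuclideanSpace ℝ (Fin n) → ℝ}

theorem inner_gradient {f : EuclideanSpace ℝ (Fin n) → ℝ} (x v : EuclideanSpace ℝ (Fin n)) :
    inner ℝ (gradient f x) v = fderiv ℝ f x v := by
  rw [gradient, InnerProductSpace.toDual_symm_apply]

theorem _root_.ContDiff.continuous_gradient {f : EuclideanSpace ℝ (Fin n) → ℝ}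
    (hf : ContDiff ℝ ∞ f) : Continuous (gradient f) :=
  (InnerProductSpace.toDual ℝ (EuclideanSpace ℝ (Fin n))).symm.continuous.comp
    (hf.continuous_fderiv (by simp))

namespace IsDefiningFunctionAt

/-- A frontier point is not in the open set `Ω`, so $\rho\ge0$ there; $\rho>0$ would persist nearby
and keep `Ω` away. -/
theorem eventually_eq_zero (h : IsDefiningFunctionAt Ω p ρ) (hΩ : IsOpen Ω) :
    ∀ᶠ x in 𝓝 p, x ∈ frontier Ω → ρ x = 0 := by
  filter_upwards [h.2.2.eventually_nhds] with x hx hxf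
  rw [hΩ.frontier_eq] at hxf
  have h1 : 0 ≤ ρ x := not_lt.1 fun h0 => hxf.2 (hx.self_of_nhds.2 h0)
  refine le_antisymm ?_ h1
  by_contra! hpos
  have h2 : ∀ᶠ y in 𝓝 x, 0 < ρ y := h.1.continuous.continuousAt.eventually (lt_mem_nhds hpos)
  obtain ⟨y, hy, hy1, hy2⟩ := ((mem_closure_iff_frequently.1 hxf.1).and_eventually
    (hx.and h2)).exists
  exact (hy1.1 hy).not_gt hy2

theorem apply_eq_zero (h : IsDefiningFunctionAt Ω p ρ) (hΩ : IsOpen Ω) (hp : p ∈ frontier Ω) :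
    ρ p = 0 :=
  (h.eventually_eq_zero hΩ).self_of_nhds hp

theorem eventually (h : IsDefiningFunctionAt Ω p ρ) :
    ∀ᶠ q in 𝓝 p, IsDefiningFunctionAt Ω q ρ := by
  have h1 : ∀ᶠ q in 𝓝 p, gradient ρ q ≠ 0 :=
    h.1.continuous_gradient.continuousAt.eventually_ne h.2.1
  filter_upwards [h1, h.2.2.eventually_nhds] with q hq hq'
  exact ⟨h.1, hq, hq'⟩

theorem hasStrictFDerivAt (h : IsDefiningFunctionAt Ω p ρ) (x : EuclideanSpace ℝ (Fin n)) :
    HasStrictFDerivAt ρ (fderiv ℝ ρ x) x :=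
  h.1.contDiffAt.hasStrictFDerivAt (by simp)

theorem eventually_neg_along (h : IsDefiningFunctionAt Ω p ρ) (h0 : ρ p = 0)
    {w : EuclideanSpace ℝ (Fin n)} (hw : inner ℝ (gradient ρ p) w < 0) :
    ∀ᶠ t in 𝓝[>] (0 : ℝ), ρ (p + t • w) < 0 := by
  have h1 : HasDerivAt (fun t : ℝ => p + t • w) w 0 := by
    simpa using ((hasDerivAt_id (0 : ℝ)).smul_const w).const_add p
  have h2 : HasDerivAt (fun t : ℝ => ρ (p + t • w)) (fderiv ℝ ρ p w) 0 := by
    refine HasFDerivAt.comp_hasDerivAt (0 : ℝ) ?_ h1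
    simpa using (h.hasStrictFDerivAt p).hasFDerivAt
  rw [inner_gradient] at hw
  have h3 := (hasDerivAt_iff_tendsto_slope.1 h2).eventually (gt_mem_nhds hw)
  have h4 : 𝓝[>] (0 : ℝ) ≤ 𝓝[≠] 0 := nhdsWithin_mono _ fun x hx => ne_of_gt hx
  filter_upwards [h3.filter_mono h4, self_mem_nhdsWithin] with t ht ht0
  have ht0 : (0 : ℝ) < t := ht0
  simp only [slope_def_field, zero_smul, add_zero, h0, sub_zero] at ht
  by_contra! hcon
  exact absurd ht (not_lt.2 (div_nonneg hcon ht0.le))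

theorem eventually_pos_along (h : IsDefiningFunctionAt Ω p ρ) (h0 : ρ p = 0)
    {w : EuclideanSpace ℝ (Fin n)} (hw : 0 < inner ℝ (gradient ρ p) w) :
    ∀ᶠ t in 𝓝[>] (0 : ℝ), 0 < ρ (p + t • w) := by
  have h1 : HasDerivAt (fun t : ℝ => p + t • w) w 0 := by
    simpa using ((hasDerivAt_id (0 : ℝ)).smul_const w).const_add p
  have h2 : HasDerivAt (fun t : ℝ => ρ (p + t • w)) (fderiv ℝ ρ p w) 0 := by
    refine HasFDerivAt.comp_hasDerivAt (0 : ℝ) ?_ h1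
    simpa using (h.hasStrictFDerivAt p).hasFDerivAt
  rw [inner_gradient] at hw
  have h3 := (hasDerivAt_iff_tendsto_slope.1 h2).eventually (lt_mem_nhds hw)
  have h4 : 𝓝[>] (0 : ℝ) ≤ 𝓝[≠] 0 := nhdsWithin_mono _ fun x hx => ne_of_gt hx
  filter_upwards [h3.filter_mono h4, self_mem_nhdsWithin] with t ht ht0
  have ht0 : (0 : ℝ) < t := ht0
  simp only [slope_def_field, zero_smul, add_zero, h0, sub_zero] at ht
  by_contra! hcon
  exact absurd ht (not_lt.2 (div_nonpos_of_nonpos_of_nonneg hcon ht0.le))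

/-- Two defining functions have the same normalized gradient. -/
theorem normalized_gradient_eq (h : IsDefiningFunctionAt Ω p ρ)
    (h' : IsDefiningFunctionAt Ω p ρ') (hΩ : IsOpen Ω) (hp : p ∈ frontier Ω) :
    ‖gradient ρ p‖⁻¹ • gradient ρ p = ‖gradient ρ' p‖⁻¹ • gradient ρ' p := by
  set a := gradient ρ p with ha
  set b := gradient ρ' p with hb
  have na : 0 < ‖a‖ := norm_pos_iff.2 h.2.1
  have nb : 0 < ‖b‖ := norm_pos_iff.2 h'.2.1
  have ua : ‖‖a‖⁻¹ • a‖ = 1 := by rw [norm_smul, norm_inv, norm_norm, inv_mul_cancel₀ na.ne']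
  have ub : ‖‖b‖⁻¹ • b‖ = 1 := by rw [norm_smul, norm_inv, norm_norm, inv_mul_cancel₀ nb.ne']
  -- If the unit gradients $\hat a,\hat b$ of `ρ` and `ρ'` differ, then moving from `p` in the
  -- direction $\hat b-\hat a$ decreases `ρ` and increases `ρ'`: nearby points would be both inside
  -- and outside `Ω`.
  by_contra hne
  have hlt : inner ℝ (‖a‖⁻¹ • a) (‖b‖⁻¹ • b) < (1 : ℝ) :=
    (inner_lt_one_iff_real_of_norm_eq_one ua ub).2 hne
  have h1 : inner ℝ a (‖b‖⁻¹ • b - ‖a‖⁻¹ • a) < 0 := by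
    have e : a = ‖a‖ • (‖a‖⁻¹ • a) := by rw [smul_smul, mul_inv_cancel₀ na.ne', one_smul]
    nth_rewrite 1 [e]
    rw [inner_smul_left, inner_sub_right, real_inner_self_eq_norm_sq (‖a‖⁻¹ • a), ua]
    exact mul_neg_of_pos_of_neg na (by linarith)
  have h2 : 0 < inner ℝ b (‖b‖⁻¹ • b - ‖a‖⁻¹ • a) := by
    have e : b = ‖b‖ • (‖b‖⁻¹ • b) := by rw [smul_smul, mul_inv_cancel₀ nb.ne', one_smul]
    nth_rewrite 1 [e]
    rw [inner_smul_left, inner_sub_right, real_inner_self_eq_norm_sq (‖b‖⁻¹ • b), ub,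
      real_inner_comm]
    exact mul_pos nb (by linarith)
  have hcont : Filter.Tendsto (fun t : ℝ => p + t • (‖b‖⁻¹ • b - ‖a‖⁻¹ • a)) (𝓝[>] 0) (𝓝 p) := by
    have : Continuous (fun t : ℝ => p + t • (‖b‖⁻¹ • b - ‖a‖⁻¹ • a)) := by fun_prop
    have h0 := this.tendsto 0
    rw [zero_smul, add_zero] at h0
    exact h0.mono_left nhdsWithin_le_nhds
  obtain ⟨t, ht1, ht2, ht3, ht4⟩ := ((h.eventually_neg_along (h.apply_eq_zero hΩ hp) h1).and
    ((h'.eventually_pos_along (h'.apply_eq_zero hΩ hp) h2).and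
      ((hcont.eventually h.2.2).and (hcont.eventually h'.2.2)))).exists
  exact (ht4.1 (ht3.2 ht1)).not_gt ht2

/-- Near a boundary point a smooth domain is close to a half-space. -/
theorem exists_isNearlyHalfSpace (h : IsDefiningFunctionAt Ω p ρ) (hΩ : IsOpen Ω)
    {ε : ℝ} (hε : 0 < ε) (hε' : ε ≤ 1 / 6) :
    ∃ r₀ > 0, ∀ r ≤ r₀, IsNearlyHalfSpace Ω p r (‖gradient ρ p‖⁻¹ • gradient ρ p) ρ
      ‖gradient ρ p‖ ε := by
  have na : 0 < ‖gradient ρ p‖ := norm_pos_iff.2 h.2.1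
  -- Strict differentiability is what compares two arbitrary points near `p`, rather than one point
  -- with `p`.
  have h1 := (h.hasStrictFDerivAt p).isLittleO.def (mul_pos na hε)
  rw [nhds_prod_eq] at h1
  obtain ⟨t, ht, ht'⟩ := Filter.eventually_prod_self_iff'.1 h1
  have h2 : ∀ᶠ x in 𝓝 p, x ∈ t ∧ (x ∈ Ω ↔ ρ x < 0) ∧ (x ∈ frontier Ω → ρ x = 0) :=
    Filter.Eventually.and ht (h.2.2.and (h.eventually_eq_zero hΩ))
  obtain ⟨r₀, hr₀, hball⟩ := Metric.eventually_nhds_iff_ball.1 h2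
  refine ⟨r₀, hr₀, fun r hr => ⟨?_, na, hε.le, hε', ?_, ?_, ?_⟩⟩
  · rw [norm_smul, norm_inv, norm_norm, inv_mul_cancel₀ na.ne']
  · exact fun x hx => (hball x (Metric.ball_subset_ball hr hx)).2.1
  · exact fun x hx => (hball x (Metric.ball_subset_ball hr hx)).2.2
  · intro x hx y hy
    have := ht' x (hball x (Metric.ball_subset_ball hr hx)).1 y
      (hball y (Metric.ball_subset_ball hr hy)).1
    rw [real_inner_smul_left, mul_inv_cancel_left₀ na.ne', inner_gradient]
    simpa only [Real.norm_eq_abs] using this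

end IsDefiningFunctionAt

/-- The outward unit normal of `Ω` at a boundary point. -/
noncomputable def outwardNormal (Ω : Set (EuclideanSpace ℝ (Fin n)))
    (p : EuclideanSpace ℝ (Fin n)) : EuclideanSpace ℝ (Fin n) :=
  ‖gradient (boundaryDefiningFunction Ω p) p‖⁻¹ • gradient (boundaryDefiningFunction Ω p) p

theorem HasSmoothBoundary.isDefiningFunctionAt (hs : HasSmoothBoundary Ω) (hp : p ∈ frontier Ω) :
    IsDefiningFunctionAt Ω p (boundaryDefiningFunction Ω p) := by
  rw [boundaryDefiningFunction, dif_pos (hs p hp)]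
  exact (hs p hp).choose_spec

theorem HasSmoothBoundary.outwardNormal_eq (hs : HasSmoothBoundary Ω) (hΩ : IsOpen Ω)
    (hp : p ∈ frontier Ω) (h : IsDefiningFunctionAt Ω p ρ) :
    outwardNormal Ω p = ‖gradient ρ p‖⁻¹ • gradient ρ p :=
  (hs.isDefiningFunctionAt hp).normalized_gradient_eq h hΩ hp

theorem HasSmoothBoundary.norm_outwardNormal (hs : HasSmoothBoundary Ω) (hp : p ∈ frontier Ω) :
    ‖outwardNormal Ω p‖ = 1 := by
  rw [outwardNormal, norm_smul, norm_inv, norm_norm,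
    inv_mul_cancel₀ (norm_ne_zero_iff.2 (hs.isDefiningFunctionAt hp).2.1)]

/-- The defining function chosen in `outwardNormal` changes from point to point, but the normal does
not depend on it, so one defining function serves all boundary points near `p`. -/
theorem HasSmoothBoundary.continuousOn_outwardNormal (hs : HasSmoothBoundary Ω)
    (hΩ : IsOpen Ω) : ContinuousOn (outwardNormal Ω) (frontier Ω) := by
  intro p hp
  have h := hs.isDefiningFunctionAt hp
  set ρ := boundaryDefiningFunction Ω p
  have hc : ContinuousAt (fun q => ‖gradient ρ q‖⁻¹ • gradient ρ q) p :=
    (h.1.continuous_gradient.norm.continuousAt.inv₀ (norm_ne_zero_iff.2 h.2.1)).smul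
      h.1.continuous_gradient.continuousAt
  refine hc.continuousWithinAt.congr_of_eventuallyEq ?_ (hs.outwardNormal_eq hΩ hp h)
  filter_upwards [self_mem_nhdsWithin, mem_nhdsWithin_of_mem_nhds h.eventually] with q hq hq'
  exact hs.outwardNormal_eq hΩ hq hq'

end Normal

/-! ### The divergence theorem -/

theorem fderiv_coord {m n : ℕ} {Y : EuclideanSpace ℝ (Fin m) → EuclideanSpace ℝ (Fin n)}
    {x : EuclideanSpace ℝ (Fin m)} (hY : DifferentiableAt ℝ Y x) (i : Fin n)
    (v : EuclideanSpace ℝ (Fin m)) : fderiv ℝ (fun y => Y y i) x v = fderiv ℝ Y x v i := by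
  have h : fderiv ℝ (fun y => Y y i) x =
      (EuclideanSpace.proj i : EuclideanSpace ℝ (Fin n) →L[ℝ] ℝ).comp (fderiv ℝ Y x) :=
    ((EuclideanSpace.proj i : EuclideanSpace ℝ (Fin n) →L[ℝ] ℝ).hasFDerivAt.comp x
      hY.hasFDerivAt).fderiv
  rw [h]; rfl

section Divergence

variable {d : ℕ} {Ω : Set (EuclideanSpace ℝ (Fin (d + 1)))}

instance (d : ℕ) : Fact (Module.finrank ℝ (EuclideanSpace ℝ (Fin (d + 1))) = d + 1) :=
  ⟨finrank_euclideanSpace_fin⟩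

theorem surfaceMeasure_eq (Ω : Set (EuclideanSpace ℝ (Fin (d + 1)))) :
    surfaceMeasure Ω = μHE[d].restrict (frontier Ω) := rfl

theorem HasSmoothBoundary.isFiniteMeasure (hs : HasSmoothBoundary Ω) (hΩ : IsOpen Ω)
    (hb : Bornology.IsBounded Ω) : IsFiniteMeasure (surfaceMeasure Ω) := by
  have hK : IsCompact (frontier Ω) :=
    hb.isCompact_closure.of_isClosed_subset isClosed_frontier frontier_subset_closure
  refine ⟨?_⟩
  rw [surfaceMeasure_eq, Measure.restrict_apply_univ]
  refine hK.measure_lt_top_of_nhdsWithin fun p hp => ?_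
  obtain ⟨r, hr, H⟩ := (hs.isDefiningFunctionAt hp).exists_isNearlyHalfSpace hΩ
    (ε := 1 / 6) (by norm_num) le_rfl
  exact ⟨_, inter_mem_nhdsWithin _ (Metric.ball_mem_nhds p hr),
    (H r le_rfl).euclideanHausdorffMeasure_lt_top⟩

theorem HasSmoothBoundary.integrable_of_continuousOn (hs : HasSmoothBoundary Ω) (hΩ : IsOpen Ω)
    (hb : Bornology.IsBounded Ω) {f : EuclideanSpace ℝ (Fin (d + 1)) → ℝ}
    (hf : ContinuousOn f (frontier Ω)) : Integrable f (surfaceMeasure Ω) := by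
  have hK : IsCompact (frontier Ω) :=
    hb.isCompact_closure.of_isClosed_subset isClosed_frontier frontier_subset_closure
  have := hs.isFiniteMeasure hΩ hb
  have := hf.integrableOn_compact (μ := surfaceMeasure Ω) hK
  rwa [IntegrableOn, surfaceMeasure_eq, Measure.restrict_restrict isClosed_frontier.measurableSet,
    Set.inter_self] at this

/-- At interior points both integrals vanish. At a boundary point with normal `e` the direction `w`
may be tangential; the slicing estimate is applied to the transverse directions `w + 2e` and `e` and
combined by linearity. Continuity of the normal then allows `e` to be replaced by the normal at `x`.
-/
theorem HasSmoothBoundary.exists_nhds_abs_sub_le (hs : HasSmoothBoundary Ω) (hΩ : IsOpen Ω)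
    (hb : Bornology.IsBounded Ω) {w : EuclideanSpace ℝ (Fin (d + 1))} (hw : ‖w‖ ≤ 1) {η : ℝ}
    (hη : 0 < η) {p : EuclideanSpace ℝ (Fin (d + 1))} (hp : p ∈ closure Ω) :
    ∃ U, IsOpen U ∧ p ∈ U ∧ ∀ f : EuclideanSpace ℝ (Fin (d + 1)) → ℝ, ContDiff ℝ 1 f →
      HasCompactSupport f → tsupport f ⊆ U →
      |(∫ x in Ω, fderiv ℝ f x w) -
          ∫ x, f x * inner ℝ (outwardNormal Ω x) w ∂surfaceMeasure Ω| ≤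
        η * ∫ x, |f x| ∂surfaceMeasure Ω := by
  by_cases hpΩ : p ∈ Ω
  · refine ⟨Ω, hΩ, hpΩ, fun f hf hfc hfs => ?_⟩
    have h1 : ∫ x in Ω, fderiv ℝ f x w = 0 := by
      rw [setIntegral_eq_integral_of_forall_compl_eq_zero]
      · have := integral_mul_fderiv_eq_neg_fderiv_mul_of_integrable (μ := volume)
          (f := fun _ => (1 : ℝ)) (g := f) (v := w) (by simp) ?_ ?_ (by simp)
          (fun x _ => hf.differentiable one_ne_zero x)
        · simpa using this
        · simp only [one_mul]
          exact Continuous.integrable_of_hasCompactSupport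
            ((hf.continuous_fderiv one_ne_zero).clm_apply continuous_const)
            (hfc.fderiv_apply (𝕜 := ℝ) w)
        · simp only [one_mul]
          exact hf.continuous.integrable_of_hasCompactSupport hfc
      · intro x hx
        have : fderiv ℝ f x = 0 := by
          by_contra h0
          exact hx (hfs (support_fderiv_subset ℝ h0))
        rw [this]; rfl
    have h2 : ∫ x, f x * inner ℝ (outwardNormal Ω x) w ∂surfaceMeasure Ω = 0 := by
      rw [surfaceMeasure_eq]
      refine setIntegral_eq_zero_of_forall_eq_zero fun x hx => ?_
      have : f x = 0 := by
        by_contra h0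
        rw [hΩ.frontier_eq] at hx
        exact hx.2 (hfs (subset_tsupport f h0))
      rw [this, zero_mul]
    rw [h1, h2, sub_zero, abs_zero]
    exact mul_nonneg hη.le (integral_nonneg fun x => abs_nonneg _)
  · have hpf : p ∈ frontier Ω := by rw [hΩ.frontier_eq]; exact ⟨hp, hpΩ⟩
    have h := hs.isDefiningFunctionAt hpf
    set e := outwardNormal Ω p with he
    have he1 : ‖e‖ = 1 := hs.norm_outwardNormal hpf
    have hee : inner ℝ e e = (1 : ℝ) := by rw [real_inner_self_eq_norm_sq, he1]; norm_num
    -- The error budget is $6\delta$: $3\delta$ from `w + 2e`, $2\delta$ from twice `e`, and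
    -- $\delta$ from freezing the normal.
    obtain ⟨δ, hδ⟩ : ∃ δ : NNReal, (δ : ℝ) = η / 6 := ⟨⟨η / 6, by positivity⟩, rfl⟩
    have hδ0 : (0 : ℝ) < δ := by rw [hδ]; positivity
    obtain ⟨ε, hε, hε', hεδ⟩ : ∃ ε : ℝ, 0 < ε ∧ ε ≤ 1 / 6 ∧ (1 + 6 * ε) ^ d ≤ 1 + (δ : ℝ) := by
      have hcont : Continuous fun ε : ℝ => (1 + 6 * ε) ^ d := by fun_prop
      have h1 : ∀ᶠ ε in 𝓝 (0 : ℝ), (1 + 6 * ε) ^ d < 1 + (δ : ℝ) :=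
        hcont.continuousAt.eventually (gt_mem_nhds (by simpa using hδ0))
      have h2 : ∀ᶠ ε in 𝓝[>] (0 : ℝ), ε < 1 / 6 :=
        nhdsWithin_le_nhds (gt_mem_nhds (by norm_num))
      have h3 : ∀ᶠ ε in 𝓝[>] (0 : ℝ), 0 < ε := self_mem_nhdsWithin
      obtain ⟨ε, ha, hb', hc⟩ := ((h1.filter_mono nhdsWithin_le_nhds).and (h2.and h3)).exists
      exact ⟨ε, hc, hb'.le, ha.le⟩
    obtain ⟨r₀, hr₀, H₀⟩ := h.exists_isNearlyHalfSpace hΩ hε hε'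
    obtain ⟨r₁, hr₁, hν⟩ := Metric.continuousWithinAt_iff.1
      (hs.continuousOn_outwardNormal hΩ p hpf) δ hδ0
    have H := H₀ (min r₀ r₁) (min_le_left _ _)
    refine ⟨Metric.ball p (min r₀ r₁), Metric.isOpen_ball,
      Metric.mem_ball_self (lt_min hr₀ hr₁), fun f hf hfc hfs => ?_⟩
    have hfi : Integrable f (surfaceMeasure Ω) :=
      hs.integrable_of_continuousOn hΩ hb hf.continuous.continuousOn
    have hwe : |inner ℝ e w| ≤ (1 : ℝ) := by
      refine (abs_real_inner_le_norm e w).trans ?_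
      rw [he1, one_mul]; exact hw
    have hv1 : 1 ≤ inner ℝ e (w + (2 : ℝ) • e) := by
      rw [inner_add_right, inner_smul_right, hee]
      linarith [(abs_le.1 hwe).1]
    have hv3 : inner ℝ e (w + (2 : ℝ) • e) ≤ 3 := by
      rw [inner_add_right, inner_smul_right, hee]
      linarith [(abs_le.1 hwe).2]
    have hvn : ‖w + (2 : ℝ) • e‖ ≤ 3 := by
      refine (norm_add_le _ _).trans ?_
      rw [norm_smul, he1]; norm_num; linarith
    have E₁ := H.abs_setIntegral_fderiv_sub_le hΩ hv1 hvn hεδ hf hfs hfi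
    have E₂ := H.abs_setIntegral_fderiv_sub_le hΩ (v := e) hee.ge (by rw [he1]; norm_num) hεδ hf hfs
      hfi
    change |_ - inner ℝ e (w + (2 : ℝ) • e) * ∫ x, f x ∂surfaceMeasure Ω| ≤
      inner ℝ e (w + (2 : ℝ) • e) * (δ * ∫ x, |f x| ∂surfaceMeasure Ω) at E₁
    change |_ - inner ℝ e e * ∫ x, f x ∂surfaceMeasure Ω| ≤
      inner ℝ e e * (δ * ∫ x, |f x| ∂surfaceMeasure Ω) at E₂
    have hνi : Integrable (fun x => f x * inner ℝ (outwardNormal Ω x) w) (surfaceMeasure Ω) :=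
      hs.integrable_of_continuousOn hΩ hb (hf.continuous.continuousOn.mul
        ((hs.continuousOn_outwardNormal hΩ).inner continuousOn_const))
    have E₃ : |inner ℝ e w * (∫ x, f x ∂surfaceMeasure Ω) -
        ∫ x, f x * inner ℝ (outwardNormal Ω x) w ∂surfaceMeasure Ω| ≤
        δ * ∫ x, |f x| ∂surfaceMeasure Ω := by
      rw [← integral_const_mul, ← integral_sub (hfi.const_mul _) hνi, ← integral_const_mul]
      refine (abs_integral_le_integral_abs).trans ?_
      rw [surfaceMeasure_eq]
      refine setIntegral_mono_on ((hfi.const_mul _).sub hνi).abs (hfi.abs.const_mul _)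
        isClosed_frontier.measurableSet fun x hx => ?_
      by_cases hx0 : f x = 0
      · simp [hx0]
      have hxb := hfs (subset_tsupport f hx0)
      have h1 := hν hx (lt_of_lt_of_le hxb (min_le_right _ _))
      have h2 : inner ℝ e w * f x - f x * inner ℝ (outwardNormal Ω x) w =
          f x * inner ℝ (e - outwardNormal Ω x) w := by rw [inner_sub_left]; ring
      rw [h2, abs_mul, mul_comm]
      refine mul_le_mul_of_nonneg_right ?_ (abs_nonneg _)
      refine (abs_real_inner_le_norm _ _).trans ?_
      rw [dist_comm, dist_eq_norm] at h1
      calc _ ≤ (δ : ℝ) * 1 := mul_le_mul h1.le hw (norm_nonneg _) hδ0.le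
        _ = δ := mul_one _
    have hi : ∀ v, IntegrableOn (fun x => fderiv ℝ f x v) Ω := fun v =>
      (Continuous.integrable_of_hasCompactSupport
        ((hf.continuous_fderiv one_ne_zero).clm_apply continuous_const)
        (hfc.fderiv_apply (𝕜 := ℝ) v)).integrableOn
    have hlin : ∫ x in Ω, fderiv ℝ f x (w + (2 : ℝ) • e) =
        (∫ x in Ω, fderiv ℝ f x w) + 2 * ∫ x in Ω, fderiv ℝ f x e := by
      rw [← integral_const_mul, ← integral_add (hi w) ((hi e).const_mul 2)]
      simp
    have hI : 0 ≤ ∫ x, |f x| ∂surfaceMeasure Ω := integral_nonneg fun x => abs_nonneg _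
    have E₁' := E₁.trans (mul_le_mul_of_nonneg_right hv3 (mul_nonneg hδ0.le hI))
    rw [hlin, inner_add_right, inner_smul_right, hee] at E₁'
    rw [hee, one_mul, one_mul] at E₂
    rw [abs_le] at E₁' E₂ E₃ ⊢
    have hη6 : η = 6 * δ := by rw [hδ]; ring
    rw [hη6]
    constructor <;> nlinarith [E₁'.1, E₁'.2, E₂.1, E₂.2, E₃.1, E₃.2]

/-- The local errors $\eta\int\chi_i|f|$ sum to $\eta\int|f|$, however many pieces the partition of
unity has, and $\eta$ is arbitrary. -/
theorem HasSmoothBoundary.setIntegral_fderiv_eq (hs : HasSmoothBoundary Ω) (hΩ : IsOpen Ω)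
    (hb : Bornology.IsBounded Ω) {w : EuclideanSpace ℝ (Fin (d + 1))} (hw : ‖w‖ ≤ 1)
    {f : EuclideanSpace ℝ (Fin (d + 1)) → ℝ} (hf : ContDiff ℝ 1 f) (hfc : HasCompactSupport f) :
    ∫ x in Ω, fderiv ℝ f x w =
      ∫ x, f x * inner ℝ (outwardNormal Ω x) w ∂surfaceMeasure Ω := by
  have hI : 0 ≤ ∫ x, |f x| ∂surfaceMeasure Ω := integral_nonneg fun x => abs_nonneg _
  have hi : ∀ g : EuclideanSpace ℝ (Fin (d + 1)) → ℝ, ContDiff ℝ 1 g → HasCompactSupport g →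
      IntegrableOn (fun x => fderiv ℝ g x w) Ω := fun g hg hgc =>
    (Continuous.integrable_of_hasCompactSupport
      ((hg.continuous_fderiv one_ne_zero).clm_apply continuous_const)
      (hgc.fderiv_apply (𝕜 := ℝ) w)).integrableOn
  suffices key : ∀ η > 0, |(∫ x in Ω, fderiv ℝ f x w) -
      ∫ x, f x * inner ℝ (outwardNormal Ω x) w ∂surfaceMeasure Ω| ≤
      η * ∫ x, |f x| ∂surfaceMeasure Ω by
    refine eq_of_abs_sub_le_all fun η hη => (key (η / (1 + ∫ x, |f x| ∂surfaceMeasure Ω))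
      (by positivity)).trans ?_
    rw [div_mul_eq_mul_div, div_le_iff₀ (by positivity)]
    nlinarith
  intro η hη
  choose! U hUo hpU hU using fun p (hp : p ∈ closure Ω) =>
    hs.exists_nhds_abs_sub_le hΩ hb hw hη hp
  obtain ⟨t, htc, ht⟩ := hb.isCompact_closure.elim_nhds_subcover U
    fun p hp => (hUo p hp).mem_nhds (hpU p hp)
  obtain ⟨χ, hχ⟩ := SmoothPartitionOfUnity.exists_isSubordinate
    (modelWithCornersSelf ℝ (EuclideanSpace ℝ (Fin (d + 1)))) (isClosed_closure (s := Ω))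
    (fun i : t => U i) (fun i => hUo i (htc i i.2)) (by
      intro x hx
      obtain ⟨i, hi, hxi⟩ := Set.mem_iUnion₂.1 (ht hx)
      exact Set.mem_iUnion.2 ⟨⟨i, hi⟩, hxi⟩)
  have hχ1 : ∀ i, ContDiff ℝ 1 (χ i) := fun i =>
    (χ i).contMDiff.contDiff.of_le (by simp)
  have hsum : ∀ x ∈ closure Ω, ∑ i, χ i x = 1 := fun x hx => by
    rw [← finsum_eq_sum_of_fintype]; exact χ.sum_eq_one hx
  have hc : ∀ i, ContDiff ℝ 1 (fun x => χ i x * f x) := fun i => (hχ1 i).mul hf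
  have hcs : ∀ i, HasCompactSupport (fun x => χ i x * f x) := fun i => hfc.mul_left
  have hloc : ∀ i : t, |(∫ x in Ω, fderiv ℝ (fun x => χ i x * f x) x w) -
      ∫ x, χ i x * f x * inner ℝ (outwardNormal Ω x) w ∂surfaceMeasure Ω| ≤
      η * ∫ x, χ i x * |f x| ∂surfaceMeasure Ω := fun i => by
    have := hU i (htc i i.2) _ (hc i) (hcs i)
      ((tsupport_mul_subset_left (f := χ i) (g := f)).trans (hχ i))
    simpa only [abs_mul, abs_of_nonneg (χ.nonneg i _)] using this
  have e₁ : ∫ x in Ω, fderiv ℝ f x w =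
      ∑ i, ∫ x in Ω, fderiv ℝ (fun x => χ i x * f x) x w := by
    rw [← integral_finsetSum _ fun i _ => hi _ (hc i) (hcs i)]
    refine setIntegral_congr_fun hΩ.measurableSet fun x hx => ?_
    have hev : f =ᶠ[𝓝 x] fun y => ∑ i, χ i y * f y := by
      filter_upwards [hΩ.mem_nhds hx] with y hy
      rw [← Finset.sum_mul, hsum y (subset_closure hy), one_mul]
    beta_reduce
    rw [hev.fderiv_eq, fderiv_fun_sum fun i _ => (hc i).differentiable one_ne_zero x]
    simp
  have hsI : ∀ g : EuclideanSpace ℝ (Fin (d + 1)) → ℝ, (∀ i : t, Integrable (fun x => χ i x * g x)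
      (surfaceMeasure Ω)) → ∫ x, g x ∂surfaceMeasure Ω =
      ∑ i, ∫ x, χ i x * g x ∂surfaceMeasure Ω := by
    intro g hg
    rw [← integral_finsetSum _ fun i _ => hg i, surfaceMeasure_eq]
    refine setIntegral_congr_fun isClosed_frontier.measurableSet fun x hx => ?_
    beta_reduce
    rw [← Finset.sum_mul, hsum x (frontier_subset_closure hx), one_mul]
  have hic : ∀ g : EuclideanSpace ℝ (Fin (d + 1)) → ℝ, ContinuousOn g (frontier Ω) → ∀ i : t,
      Integrable (fun x => χ i x * g x) (surfaceMeasure Ω) := fun g hg i =>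
    hs.integrable_of_continuousOn hΩ hb ((hχ1 i).continuous.continuousOn.mul hg)
  have e₂ := hsI (fun x => f x * inner ℝ (outwardNormal Ω x) w) (hic _
    (hf.continuous.continuousOn.mul ((hs.continuousOn_outwardNormal hΩ).inner continuousOn_const)))
  have e₃ := hsI (fun x => |f x|) (hic _ hf.continuous.abs.continuousOn)
  rw [e₁, e₂, e₃, ← Finset.sum_sub_distrib, Finset.mul_sum]
  refine (Finset.abs_sum_le_sum_abs _ _).trans (Finset.sum_le_sum fun i _ => ?_)
  simpa only [mul_assoc] using hloc i

/-- **Divergence theorem** on a bounded domain with smooth boundary. -/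
theorem HasSmoothBoundary.setIntegral_divergence_eq (hs : HasSmoothBoundary Ω) (hΩ : IsOpen Ω)
    (hb : Bornology.IsBounded Ω) {V : Set (EuclideanSpace ℝ (Fin (d + 1)))} (hV : IsOpen V)
    (hΩV : closure Ω ⊆ V)
    {Y : EuclideanSpace ℝ (Fin (d + 1)) → EuclideanSpace ℝ (Fin (d + 1))}
    (hY : ContDiffOn ℝ 1 Y V) :
    ∫ x in Ω, divergence Y x = ∫ x, inner ℝ (Y x) (outwardNormal Ω x) ∂surfaceMeasure Ω := by
  -- A cutoff equal to 1 on the closure of `Ω` and supported in `V` makes the components of `Y`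
  -- globally $C^1$ with compact support, without changing either side.
  obtain ⟨W, hWo, hΩW, hWV, hWc⟩ :=
    exists_open_between_and_isCompact_closure hb.isCompact_closure hV hΩV
  obtain ⟨χ, hχ0, hχ1, -⟩ := exists_contMDiffMap_zero_one_of_isClosed (n := 1)
    (modelWithCornersSelf ℝ (EuclideanSpace ℝ (Fin (d + 1)))) hWo.isClosed_compl
    (isClosed_closure (s := Ω)) (Set.disjoint_compl_left_iff_subset.2 hΩW)
  have hχ : ContDiff ℝ 1 χ := χ.contMDiff.contDiff
  have hχs : tsupport χ ⊆ closure W := closure_mono fun x hx => by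
    by_contra hxW
    exact hx (hχ0 hxW)
  have hχc : HasCompactSupport χ := hWc.of_isClosed_subset (isClosed_tsupport _) hχs
  set f : Fin (d + 1) → EuclideanSpace ℝ (Fin (d + 1)) → ℝ := fun i x => χ x * Y x i with hfdef
  have hf : ∀ i, ContDiff ℝ 1 (f i) := fun i => by
    refine contDiff_iff_contDiffAt.2 fun x => ?_
    by_cases hx : x ∈ V
    · have hYx : ContDiffAt ℝ 1 (fun x => Y x i) x :=
        (contDiffAt_euclidean.1 (hY.contDiffAt (hV.mem_nhds hx))) i
      exact hχ.contDiffAt.mul hYx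
    · have hev : f i =ᶠ[𝓝 x] fun _ => 0 := by
        filter_upwards [(isClosed_tsupport χ).isOpen_compl.mem_nhds
          (show x ∈ (tsupport χ)ᶜ from fun h => hx (hWV (hχs h)))] with y hy
        have h0 : χ y = 0 := image_eq_zero_of_notMem_tsupport hy
        simp only [hfdef, h0, zero_mul]
      exact contDiffAt_const.congr_of_eventuallyEq hev
  have hfc : ∀ i, HasCompactSupport (f i) := fun i => hχc.mul_right
  have key : ∀ i, ∫ x in Ω, fderiv ℝ (f i) x (EuclideanSpace.single i 1) =
      ∫ x, f i x * outwardNormal Ω x i ∂surfaceMeasure Ω := fun i => by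
    rw [hs.setIntegral_fderiv_eq hΩ hb (by simp) (hf i) (hfc i)]
    simp [EuclideanSpace.inner_single_right]
  have l₁ : ∫ x in Ω, divergence Y x =
      ∑ i, ∫ x in Ω, fderiv ℝ (f i) x (EuclideanSpace.single i 1) := by
    rw [← integral_finsetSum]
    · refine setIntegral_congr_fun hΩ.measurableSet fun x hx => ?_
      simp only [divergence, partialDeriv]
      refine Finset.sum_congr rfl fun i _ => ?_
      have hev : f i =ᶠ[𝓝 x] fun y => Y y i := by
        filter_upwards [hΩ.mem_nhds hx] with y hy
        simp only [hfdef, hχ1 (subset_closure hy), Pi.one_apply, one_mul]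
      have hYd : DifferentiableAt ℝ Y x :=
        (hY.contDiffAt (hV.mem_nhds (hΩV (subset_closure hx)))).differentiableAt one_ne_zero
      rw [hev.fderiv_eq]
      exact (fderiv_coord hYd i _).symm
    · intro i _
      exact (Continuous.integrable_of_hasCompactSupport
        (((hf i).continuous_fderiv one_ne_zero).clm_apply continuous_const)
        ((hfc i).fderiv_apply (𝕜 := ℝ) _)).integrableOn
  rw [l₁, Finset.sum_congr rfl fun i _ => key i, ← integral_finsetSum]
  · rw [surfaceMeasure_eq]
    refine setIntegral_congr_fun isClosed_frontier.measurableSet fun x hx => ?_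
    simp only [hfdef, hχ1 (frontier_subset_closure hx), Pi.one_apply, one_mul, PiLp.inner_apply]
    simp [mul_comm]
  · intro i _
    exact hs.integrable_of_continuousOn hΩ hb ((hf i).continuous.continuousOn.mul
      (((EuclideanSpace.proj i : EuclideanSpace ℝ (Fin (d + 1)) →L[ℝ] ℝ).continuous.comp_continuousOn
        (hs.continuousOn_outwardNormal hΩ))))

end Divergence

/-! ### The shape operator of a graph -/

section Pointwise

variable {n : ℕ}

theorem sum_apply_smul_single (x : EuclideanSpace ℝ (Fin n)) :
    ∑ i, x i • EuclideanSpace.single i (1 : ℝ) = x := by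
  ext j
  simp [Pi.single_apply]

theorem map_eq_sum {F : Type*} [NormedAddCommGroup F] [NormedSpace ℝ F]
    (L : EuclideanSpace ℝ (Fin n) →L[ℝ] F) (x : EuclideanSpace ℝ (Fin n)) :
    L x = ∑ i, x i • L (EuclideanSpace.single i (1 : ℝ)) := by
  conv_lhs => rw [← sum_apply_smul_single x]
  simp

theorem _root_.ContDiffAt.gradient {f : EuclideanSpace ℝ (Fin n) → ℝ}
    {x : EuclideanSpace ℝ (Fin n)} (hf : ContDiffAt ℝ ∞ f x) : ContDiffAt ℝ ∞ (gradient f) x :=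
  (InnerProductSpace.toDual ℝ (EuclideanSpace ℝ (Fin n))).symm.contDiff.contDiffAt.comp x
    (hf.fderiv_right (by simp))

/-- The vector field `w⁻¹ Du`, whose Jacobian is the shape operator. -/
noncomputable def slopeField (u : EuclideanSpace ℝ (Fin n) → ℝ) (x : EuclideanSpace ℝ (Fin n)) :
    EuclideanSpace ℝ (Fin n) :=
  (√(1 - ‖gradient u x‖ ^ 2))⁻¹ • gradient u x

variable {u : EuclideanSpace ℝ (Fin n) → ℝ} {x : EuclideanSpace ℝ (Fin n)}

theorem one_sub_norm_gradient_sq_pos (h : ‖gradient u x‖ < 1) : 0 < 1 - ‖gradient u x‖ ^ 2 := by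
  have := norm_nonneg (gradient u x)
  nlinarith

theorem lapse_pos (h : ‖gradient u x‖ < 1) : 0 < lapse u x :=
  Real.sqrt_pos.2 (one_sub_norm_gradient_sq_pos h)

theorem lapse_sq (h : ‖gradient u x‖ < 1) : lapse u x ^ 2 = 1 - ‖gradient u x‖ ^ 2 :=
  Real.sq_sqrt (one_sub_norm_gradient_sq_pos h).le

theorem contDiffAt_lapse (hu : ContDiffAt ℝ ∞ u x) (h : ‖gradient u x‖ < 1) :
    ContDiffAt ℝ ∞ (lapse u) x :=
  (contDiffAt_const.sub (hu.gradient.norm_sq ℝ)).sqrt (one_sub_norm_gradient_sq_pos h).ne'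

theorem contDiffAt_slopeField (hu : ContDiffAt ℝ ∞ u x) (h : ‖gradient u x‖ < 1) :
    ContDiffAt ℝ ∞ (slopeField u) x :=
  ((contDiffAt_lapse hu h).inv (lapse_pos h).ne').smul hu.gradient

theorem fderiv_inv_lapse (hu : ContDiffAt ℝ ∞ u x) (h : ‖gradient u x‖ < 1)
    (v : EuclideanSpace ℝ (Fin n)) :
    fderiv ℝ (fun y => (lapse u y)⁻¹) x v =
      (lapse u x ^ 3)⁻¹ * inner ℝ (gradient u x) (fderiv ℝ (gradient u) x v) := by
  have hg : HasFDerivAt (gradient u) (fderiv ℝ (gradient u) x) x :=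
    (hu.gradient.differentiableAt (by simp)).hasFDerivAt
  have hw := lapse_pos h
  have h1 := ((hg.norm_sq.const_sub 1).sqrt (one_sub_norm_gradient_sq_pos h).ne')
  have h2 : HasFDerivAt (lapse u) _ x := h1
  have h3 := (hasDerivAt_inv hw.ne').comp_hasFDerivAt x h2
  have h4 : HasFDerivAt (fun y => (lapse u y)⁻¹) _ x := h3
  rw [h4.fderiv]
  rw [show √(1 - ‖gradient u x‖ ^ 2) = lapse u x from rfl]
  simp only [_root_.smul_apply, _root_.neg_apply,
    ContinuousLinearMap.comp_apply, innerSL_apply_apply, smul_eq_mul, nsmul_eq_mul]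
  field_simp
  norm_num

theorem fderiv_slopeField (hu : ContDiffAt ℝ ∞ u x) (h : ‖gradient u x‖ < 1)
    (v : EuclideanSpace ℝ (Fin n)) :
    fderiv ℝ (slopeField u) x v = (lapse u x)⁻¹ • fderiv ℝ (gradient u) x v +
      ((lapse u x ^ 3)⁻¹ * inner ℝ (gradient u x) (fderiv ℝ (gradient u) x v)) •
        gradient u x := by
  have hg := hu.gradient.differentiableAt (by simp)
  have hw : DifferentiableAt ℝ (fun y => (lapse u y)⁻¹) x :=
    ((contDiffAt_lapse hu h).inv (lapse_pos h).ne').differentiableAt (by simp)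
  have h1 : slopeField u = fun y => (lapse u y)⁻¹ • gradient u y := rfl
  rw [h1, fderiv_fun_smul hw hg]
  simp [fderiv_inv_lapse hu h]

/-- As $e_{n+1}=(X,w^{-1})$ has constant Lorentzian square $-1$, its derivatives are tangent to the
graph. -/
theorem inner_gradient_fderiv_slopeField (hu : ContDiffAt ℝ ∞ u x) (h : ‖gradient u x‖ < 1)
    (v : EuclideanSpace ℝ (Fin n)) :
    inner ℝ (gradient u x) (fderiv ℝ (slopeField u) x v) =
      fderiv ℝ (fun y => (lapse u y)⁻¹) x v := by
  have hw := lapse_pos h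
  have hw2 := lapse_sq h
  rw [fderiv_inv_lapse hu h, fderiv_slopeField hu h, inner_add_right, inner_smul_right,
    inner_smul_right, real_inner_self_eq_norm_sq,
    show ‖gradient u x‖ ^ 2 = 1 - lapse u x ^ 2 by linarith]
  field_simp
  ring

theorem gradient_apply (i : Fin n) :
    gradient u x i = fderiv ℝ u x (EuclideanSpace.single i 1) := by
  rw [← inner_gradient, EuclideanSpace.inner_single_right]
  simp

theorem partialDeriv_position (hu : ContDiffAt ℝ ∞ u x) (i : Fin n) :
    partialDeriv i (position u) x = (EuclideanSpace.single i 1, gradient u x i) := by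
  have h1 : HasFDerivAt (position u) _ x :=
    (hasFDerivAt_id x).prodMk (hu.differentiableAt (by simp)).hasFDerivAt
  rw [partialDeriv, h1.fderiv, gradient_apply]
  rfl

theorem partialDeriv_unitNormal (hu : ContDiffAt ℝ ∞ u x) (h : ‖gradient u x‖ < 1) (i : Fin n) :
    partialDeriv i (unitNormal u) x = (fderiv ℝ (slopeField u) x (EuclideanSpace.single i 1),
      fderiv ℝ (fun y => (lapse u y)⁻¹) x (EuclideanSpace.single i 1)) := by
  have hX := (contDiffAt_slopeField hu h).differentiableAt (by simp)
  have hw : DifferentiableAt ℝ (fun y => (lapse u y)⁻¹) x :=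
    ((contDiffAt_lapse hu h).inv (lapse_pos h).ne').differentiableAt (by simp)
  have h1 : unitNormal u = fun y => (slopeField u y, (lapse u y)⁻¹) := by
    ext y : 1
    simp [unitNormal, slopeField, lapse]
  rw [partialDeriv, h1, (hX.hasFDerivAt.prodMk hw.hasFDerivAt).fderiv]
  rfl

theorem metric_apply (hu : ContDiffAt ℝ ∞ u x) (i j : Fin n) :
    metric u x i j = (1 : Matrix (Fin n) (Fin n) ℝ) i j - gradient u x i * gradient u x j := by
  simp [metric, partialDeriv_position hu, lorentz, EuclideanSpace.inner_single_left,
    PiLp.single_apply, Matrix.one_apply]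

theorem metric_eq (hu : ContDiffAt ℝ ∞ u x) :
    metric u x = 1 - Matrix.vecMulVec (gradient u x).ofLp (gradient u x).ofLp := by
  ext i j
  rw [metric_apply hu, Matrix.sub_apply, Matrix.vecMulVec_apply]

theorem dotProduct_eq_inner (y z : EuclideanSpace ℝ (Fin n)) :
    y.ofLp ⬝ᵥ z.ofLp = inner ℝ y z := by
  simp [PiLp.inner_apply, dotProduct, mul_comm]

/-- Sherman–Morrison for $g=I-Du\otimes Du$, with $1-|Du|^2=w^2$. -/
theorem metric_mul (hu : ContDiffAt ℝ ∞ u x) (h : ‖gradient u x‖ < 1) :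
    metric u x * (1 + Matrix.vecMulVec (slopeField u x).ofLp (slopeField u x).ofLp) = 1 := by
  have hw := lapse_pos h
  have hw2 := lapse_sq h
  have hX : (slopeField u x).ofLp = (lapse u x)⁻¹ • (gradient u x).ofLp := rfl
  rw [metric_eq hu, hX, Matrix.smul_vecMulVec, Matrix.vecMulVec_smul, sub_mul, one_mul, mul_add,
    mul_one, Matrix.mul_smul, Matrix.mul_smul, Matrix.vecMulVec_mul_vecMulVec,
    dotProduct_eq_inner, real_inner_self_eq_norm_sq,
    show ‖gradient u x‖ ^ 2 = 1 - lapse u x ^ 2 by linarith]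
  ext i j
  simp only [Matrix.sub_apply, Matrix.add_apply, Matrix.one_apply, Matrix.smul_apply, smul_eq_mul,
    Matrix.vecMulVec_apply, Pi.smul_apply]
  field_simp
  ring

/-- The shape operator of a graph is the Jacobian matrix of `w⁻¹ Du`. -/
theorem shapeOperator_eq (hu : ContDiffAt ℝ ∞ u x) (h : ‖gradient u x‖ < 1) :
    shapeOperator u x =
      Matrix.of fun i j => fderiv ℝ (slopeField u) x (EuclideanSpace.single j 1) i := by
  have hm := metric_mul hu h
  have hinv := Matrix.inv_eq_right_inv hm
  have hm' : (metric u x)⁻¹ * metric u x = 1 := by rw [hinv]; exact mul_eq_one_comm.1 hm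
  -- The derivative of $e_{n+1}$ along $v$ is $(DX\,v,\langle Du,DX\,v\rangle)=d\phi(DX\,v)$, so
  -- $h=g\,DX$.
  have hsecond : secondFundamentalForm u x = metric u x *
      Matrix.of fun i j => fderiv ℝ (slopeField u) x (EuclideanSpace.single j 1) i := by
    rw [metric_eq hu, sub_mul, one_mul]
    ext i j
    have e1 : (Matrix.vecMulVec (gradient u x).ofLp (gradient u x).ofLp *
        Matrix.of fun i j => fderiv ℝ (slopeField u) x (EuclideanSpace.single j 1) i) i j =
        gradient u x i * inner ℝ (gradient u x)
          (fderiv ℝ (slopeField u) x (EuclideanSpace.single j 1)) := by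
      simp only [Matrix.mul_apply, Matrix.vecMulVec_apply, Matrix.of_apply, mul_assoc,
        ← Finset.mul_sum, ← dotProduct_eq_inner, dotProduct]
    rw [Matrix.sub_apply, e1, inner_gradient_fderiv_slopeField hu h]
    simp [secondFundamentalForm, partialDeriv_position hu, partialDeriv_unitNormal hu h, lorentz,
      EuclideanSpace.inner_single_left]
  rw [shapeOperator, hsecond, ← mul_assoc, hm', one_mul]

theorem meanCurvature_eq_divergence (hu : ContDiffAt ℝ ∞ u x) (h : ‖gradient u x‖ < 1) :
    meanCurvature u x = divergence (slopeField u) x := by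
  rw [meanCurvature, shapeOperator_eq hu h]
  rfl

theorem inner_fderiv_gradient_comm (hu : ContDiffAt ℝ ∞ u x) (v w : EuclideanSpace ℝ (Fin n)) :
    inner ℝ (fderiv ℝ (gradient u) x v) w = inner ℝ v (fderiv ℝ (gradient u) x w) := by
  have hsym : IsSymmSndFDerivAt ℝ u x := hu.isSymmSndFDerivAt
    (by rw [minSmoothness_of_isRCLikeNormedField]; exact WithTop.coe_le_coe.2 le_top)
  have hd : ∀ v w, inner ℝ (fderiv ℝ (gradient u) x v) w = fderiv ℝ (fderiv ℝ u) x v w := by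
    intro v w
    have h1 : DifferentiableAt ℝ (fderiv ℝ u) x :=
      (hu.fderiv_right (m := ∞) (by simp)).differentiableAt (by simp)
    have h2 : HasFDerivAt (gradient u) _ x :=
      (InnerProductSpace.toDual ℝ (EuclideanSpace ℝ
        (Fin n))).symm.toContinuousLinearEquiv.hasFDerivAt.comp x h1.hasFDerivAt
    rw [h2.fderiv]
    exact InnerProductSpace.toDual_symm_apply
  rw [hd, hsym.eq, ← hd, real_inner_comm]

/-- The matrix $\bar h$ need not be symmetric, but $\bar h=PS$ with $P=g^{-1}=I+X\otimes X$ positive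
and $S=w^{-1}D^2u-\frac Hng$ symmetric. With $Q=SPS\ge0$ the trace is
$\operatorname{tr}(PQ)=\operatorname{tr}Q+\langle X,QX\rangle$. Nonnegativity ensures that the
square root in `traceFreeNorm` loses nothing. -/
theorem trace_traceFreeForm_sq_nonneg (hu : ContDiffAt ℝ ∞ u x) (h : ‖gradient u x‖ < 1) :
    0 ≤ (traceFreeForm u x * traceFreeForm u x).trace := by
  set P := 1 + Matrix.vecMulVec (slopeField u x).ofLp (slopeField u x).ofLp with hP
  set k : Matrix (Fin n) (Fin n) ℝ := Matrix.of fun i j =>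
    (lapse u x)⁻¹ * fderiv ℝ (gradient u) x (EuclideanSpace.single j 1) i with hk
  have hPm : P * metric u x = 1 := mul_eq_one_comm.1 (metric_mul hu h)
  have hA : shapeOperator u x = P * k := by
    rw [shapeOperator_eq hu h, hP, add_mul, one_mul]
    ext i j
    have e1 : (Matrix.vecMulVec (slopeField u x).ofLp (slopeField u x).ofLp * k) i j =
        slopeField u x i * ((lapse u x)⁻¹ * inner ℝ (slopeField u x)
          (fderiv ℝ (gradient u) x (EuclideanSpace.single j 1))) := by
      simp only [Matrix.mul_apply, Matrix.vecMulVec_apply, Matrix.of_apply, mul_assoc, hk,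
        ← Finset.mul_sum, ← dotProduct_eq_inner, dotProduct]
      congr 1
      rw [Finset.mul_sum]
      exact Finset.sum_congr rfl fun _ _ => by ring
    have hX : slopeField u x = (lapse u x)⁻¹ • gradient u x := rfl
    rw [Matrix.add_apply, e1, Matrix.of_apply, fderiv_slopeField hu h, hX, real_inner_smul_left]
    simp [hk]
    field_simp
  set c := meanCurvature u x / n
  set S := k - c • metric u x with hS
  have hT : traceFreeForm u x = P * S := by
    rw [traceFreeForm, hA, hS, mul_sub, Matrix.mul_smul, hPm]
  have hSs : Sᴴ = S := by
    ext i j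
    have h1 := inner_fderiv_gradient_comm hu (EuclideanSpace.single i 1) (EuclideanSpace.single j 1)
    rw [EuclideanSpace.inner_single_left, EuclideanSpace.inner_single_right] at h1
    simp at h1
    simp [hS, hk, metric_apply hu, h1, Matrix.one_apply, mul_comm, eq_comm]
  have hPp : P.PosSemidef := by
    refine Matrix.PosSemidef.one.add ?_
    simpa using Matrix.posSemidef_vecMulVec_self_star (slopeField u x).ofLp
  have hQ : (S * P * S).PosSemidef := by
    have := hPp.conjTranspose_mul_mul_same S
    rwa [hSs] at this
  have h1 := hQ.dotProduct_mulVec_nonneg (slopeField u x).ofLp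
  have : traceFreeForm u x * traceFreeForm u x = P * (S * P * S) := by
    rw [hT]; noncomm_ring
  rw [this]
  nth_rewrite 1 [hP]
  rw [add_mul, one_mul, Matrix.trace_add, Matrix.vecMulVec_mul, Matrix.trace_vecMulVec,
    dotProduct_comm, ← Matrix.dotProduct_mulVec]
  exact add_nonneg hQ.trace_nonneg (by simpa using h1)

theorem trace_traceFreeForm_sq (hn : n ≠ 0) :
    (traceFreeForm u x * traceFreeForm u x).trace =
      (shapeOperator u x * shapeOperator u x).trace - meanCurvature u x ^ 2 / n := by
  have hn' : (n : ℝ) ≠ 0 := Nat.cast_ne_zero.2 hn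
  have hH : (shapeOperator u x).trace = meanCurvature u x := rfl
  rw [traceFreeForm, sub_mul, mul_sub, mul_sub, Matrix.smul_mul, Matrix.mul_smul, Matrix.smul_mul,
    Matrix.mul_smul]
  simp only [mul_one, one_mul, Matrix.trace_sub, Matrix.trace_smul, Matrix.trace_one, hH,
    Fintype.card_fin, smul_eq_mul]
  field_simp
  ring

end Pointwise

/-! ### The divergence of `DX X - (div X) X` -/

section Field

variable {n : ℕ} {X : EuclideanSpace ℝ (Fin n) → EuclideanSpace ℝ (Fin n)}
  {x : EuclideanSpace ℝ (Fin n)}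

/-- The vector field `DX X - (div X) X`. -/
noncomputable def secondOrderField (X : EuclideanSpace ℝ (Fin n) → EuclideanSpace ℝ (Fin n))
    (x : EuclideanSpace ℝ (Fin n)) : EuclideanSpace ℝ (Fin n) :=
  fderiv ℝ X x (X x) - divergence X x • X x

theorem contDiffAt_divergence (hX : ContDiffAt ℝ ∞ X x) : ContDiffAt ℝ ∞ (divergence X) x := by
  have hD : ContDiffAt ℝ ∞ (fderiv ℝ X) x := hX.fderiv_right (by simp)
  refine ContDiffAt.sum fun i _ => ?_
  exact contDiffAt_euclidean.1 (hD.clm_apply contDiffAt_const) i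

theorem contDiffAt_secondOrderField (hX : ContDiffAt ℝ ∞ X x) :
    ContDiffAt ℝ ∞ (secondOrderField X) x := by
  have hD : ContDiffAt ℝ ∞ (fderiv ℝ X) x := hX.fderiv_right (by simp)
  exact (hD.clm_apply hX).sub ((contDiffAt_divergence hX).smul hX)

theorem fderiv_divergence (hX : ContDiffAt ℝ ∞ X x) (v : EuclideanSpace ℝ (Fin n)) :
    fderiv ℝ (divergence X) x v =
      ∑ i, fderiv ℝ (fderiv ℝ X) x v (EuclideanSpace.single i 1) i := by
  have hD : DifferentiableAt ℝ (fderiv ℝ X) x :=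
    (hX.fderiv_right (m := ∞) (by simp)).differentiableAt (by simp)
  have h1 : ∀ i : Fin n, DifferentiableAt ℝ
      (fun y => fderiv ℝ X y (EuclideanSpace.single i (1 : ℝ))) x :=
    fun i => hD.clm_apply (differentiableAt_const _)
  have h2 : ∀ i : Fin n, DifferentiableAt ℝ
      (fun y => fderiv ℝ X y (EuclideanSpace.single i (1 : ℝ)) i) x :=
    fun i => (differentiableAt_euclidean.1 (h1 i)) i
  have h3 : divergence X = fun y => ∑ i, fderiv ℝ X y (EuclideanSpace.single i (1 : ℝ)) i := rfl
  rw [h3, fderiv_fun_sum fun i _ => h2 i, _root_.sum_apply]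
  refine Finset.sum_congr rfl fun i _ => ?_
  rw [fderiv_coord (h1 i), fderiv_clm_apply hD (differentiableAt_const _)]
  simp

/-- The second derivatives of $X$ enter as $\sum X_j\partial_i\partial_jX_i-\sum
X_j\partial_j\partial_iX_i$ and cancel by symmetry. -/
theorem divergence_secondOrderField (hX : ContDiffAt ℝ ∞ X x) :
    divergence (secondOrderField X) x =
      ((Matrix.of fun i j => fderiv ℝ X x (EuclideanSpace.single j 1) i) *
        (Matrix.of fun i j => fderiv ℝ X x (EuclideanSpace.single j 1) i)).trace -
        divergence X x ^ 2 := by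
  have hX' := hX.differentiableAt (by simp)
  have hD : DifferentiableAt ℝ (fderiv ℝ X) x :=
    (hX.fderiv_right (m := ∞) (by simp)).differentiableAt (by simp)
  have hdiv := (contDiffAt_divergence hX).differentiableAt (by simp)
  have hsym : IsSymmSndFDerivAt ℝ X x := hX.isSymmSndFDerivAt
    (by rw [minSmoothness_of_isRCLikeNormedField]; exact WithTop.coe_le_coe.2 le_top)
  have hf : ∀ v, fderiv ℝ (secondOrderField X) x v =
      fderiv ℝ X x (fderiv ℝ X x v) + fderiv ℝ (fderiv ℝ X) x v (X x) -
        (divergence X x • fderiv ℝ X x v + fderiv ℝ (divergence X) x v • X x) := by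
    intro v
    have h1 : secondOrderField X = fun y => fderiv ℝ X y (X y) - divergence X y • X y := rfl
    rw [h1, fderiv_fun_sub (hD.clm_apply hX') (hdiv.fun_smul hX'), fderiv_clm_apply hD hX',
      fderiv_fun_smul hdiv hX']
    simp
  have e1 : ∑ i, fderiv ℝ (divergence X) x (EuclideanSpace.single i 1) * X x i =
      ∑ i, fderiv ℝ (fderiv ℝ X) x (EuclideanSpace.single i 1) (X x) i := by
    have : ∑ i, fderiv ℝ (divergence X) x (EuclideanSpace.single i 1) * X x i =
        fderiv ℝ (divergence X) x (X x) := by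
      rw [map_eq_sum]
      simp [mul_comm]
    rw [this, fderiv_divergence hX]
    exact Finset.sum_congr rfl fun i _ => by rw [hsym.eq]
  have e2 : ((Matrix.of fun i j => fderiv ℝ X x (EuclideanSpace.single j 1) i) *
        (Matrix.of fun i j => fderiv ℝ X x (EuclideanSpace.single j 1) i)).trace =
      ∑ i, fderiv ℝ X x (fderiv ℝ X x (EuclideanSpace.single i 1)) i := by
    simp only [Matrix.trace, Matrix.diag, Matrix.mul_apply, Matrix.of_apply]
    refine Finset.sum_congr rfl fun i _ => ?_
    conv_rhs => rw [map_eq_sum]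
    simp [mul_comm]
  have e3 : divergence X x ^ 2 =
      ∑ i, divergence X x * fderiv ℝ X x (EuclideanSpace.single i 1) i := by
    rw [← Finset.mul_sum, sq]; rfl
  rw [e2, e3, divergence]
  simp only [partialDeriv, hf, PiLp.sub_apply, PiLp.add_apply, PiLp.smul_apply, smul_eq_mul,
    Finset.sum_sub_distrib, Finset.sum_add_distrib, e1]
  ring

end Field

/-! ### Fields that are normal to the boundary -/

section Boundary

variable {n : ℕ} {Ω : Set (EuclideanSpace ℝ (Fin n))} {p : EuclideanSpace ℝ (Fin n)}
  {ρ : EuclideanSpace ℝ (Fin n) → ℝ}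

namespace IsDefiningFunctionAt

/-- Moving from `p` along $-D\rho$ enters `Ω` at once. With `eventually_eq_zero`, the frontier is
locally the zero set of `ρ`. -/
theorem mem_frontier (h : IsDefiningFunctionAt Ω p ρ) (hΩ : IsOpen Ω) (h0 : ρ p = 0) :
    p ∈ frontier Ω := by
  have hp : p ∉ Ω := fun hp => (h.2.2.self_of_nhds.1 hp).ne h0
  rw [hΩ.frontier_eq]
  refine ⟨?_, hp⟩
  have hneg : inner ℝ (gradient ρ p) (-gradient ρ p) < 0 := by
    rw [inner_neg_right, real_inner_self_eq_norm_sq]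
    have := norm_pos_iff.2 h.2.1
    have := pow_pos this 2
    linarith
  have hcont : Filter.Tendsto (fun t : ℝ => p + t • -gradient ρ p) (𝓝[>] 0) (𝓝 p) := by
    have : Continuous (fun t : ℝ => p + t • -gradient ρ p) := by fun_prop
    have h0 := this.tendsto 0
    rw [zero_smul, add_zero] at h0
    exact h0.mono_left nhdsWithin_le_nhds
  refine mem_closure_of_tendsto hcont ?_
  filter_upwards [h.eventually_neg_along h0 hneg, hcont.eventually h.2.2] with t ht ht'
  exact ht'.2 ht

theorem eventually_mem_frontier (h : IsDefiningFunctionAt Ω p ρ) (hΩ : IsOpen Ω) :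
    ∀ᶠ q in 𝓝 p, ρ q = 0 → q ∈ frontier Ω := by
  filter_upwards [h.eventually] with q hq h0
  exact hq.mem_frontier hΩ h0

/-- The derivative of a function that vanishes on the boundary is normal to the boundary. -/
theorem exists_fderiv_eq_smul (h : IsDefiningFunctionAt Ω p ρ) (hΩ : IsOpen Ω)
    (hp : p ∈ frontier Ω) {f : EuclideanSpace ℝ (Fin n) → ℝ} (hf : ContDiffAt ℝ ∞ f p)
    (hf0 : ∀ᶠ q in 𝓝 p, q ∈ frontier Ω → f q = 0) :
    ∃ l : ℝ, ∀ v, fderiv ℝ f p v = l * inner ℝ (gradient ρ p) v := by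
  have hp0 := h.apply_eq_zero hΩ hp
  -- Being constant on the level set of `ρ` near `p`, `f` has a constrained extremum there, so
  -- Lagrange multipliers apply; the multiplier of `f` is nonzero because $D\rho(p)\ne0$.
  have hext : IsLocalExtrOn f {x | ρ x = ρ p} p := by
    refine Or.inl ?_
    have h1 : ∀ᶠ q in 𝓝[{x | ρ x = ρ p}] p, ρ q = ρ p := self_mem_nhdsWithin
    filter_upwards [h1, mem_nhdsWithin_of_mem_nhds hf0,
      mem_nhdsWithin_of_mem_nhds (h.eventually_mem_frontier hΩ)] with q hq hq1 hq2
    rw [hq1 (hq2 (hq.trans hp0)), hf0.self_of_nhds hp]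
  obtain ⟨a, b, hab, hsum⟩ := hext.exists_multipliers_of_hasStrictFDerivAt_1d
    (h.hasStrictFDerivAt p) (hf.hasStrictFDerivAt (by simp))
  have happ : ∀ v, a * fderiv ℝ ρ p v + b * fderiv ℝ f p v = 0 := fun v => by
    have := congrArg (fun L => L v) hsum
    simpa using this
  have hb : b ≠ 0 := by
    rintro rfl
    have ha : a ≠ 0 := fun ha => hab (by rw [ha]; rfl)
    refine h.2.1 ?_
    have := happ (gradient ρ p)
    rw [zero_mul, add_zero, ← inner_gradient, mul_eq_zero, or_iff_right ha,
      inner_self_eq_zero] at this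
    exact this
  refine ⟨-a / b, fun v => ?_⟩
  rw [inner_gradient]
  field_simp
  linarith [happ v]

end IsDefiningFunctionAt

theorem HasSmoothBoundary.slopeField_eq_smul (hs : HasSmoothBoundary Ω) (hΩ : IsOpen Ω)
    (hp : p ∈ frontier Ω) {u : EuclideanSpace ℝ (Fin n) → ℝ} (hu : ContDiffAt ℝ ∞ u p) {c : ℝ}
    (hc : ∀ q ∈ frontier Ω, u q = c) :
    slopeField u p = inner ℝ (slopeField u p) (outwardNormal Ω p) • outwardNormal Ω p := by
  have h := hs.isDefiningFunctionAt hp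
  obtain ⟨l, hl⟩ := h.exists_fderiv_eq_smul hΩ hp (f := fun q => u q - c)
    (hu.sub contDiffAt_const) (Filter.Eventually.of_forall fun q hq => by rw [hc q hq, sub_self])
  set ρ := boundaryDefiningFunction Ω p with hρ
  have hN := hs.norm_outwardNormal hp
  have na := norm_ne_zero_iff.2 h.2.1
  have hgr : gradient u p = l • gradient ρ p := by
    refine ext_inner_right ℝ fun v => ?_
    rw [inner_gradient, real_inner_smul_left, ← hl, fderiv_sub_const]
  have hX : ∃ m : ℝ, slopeField u p = m • outwardNormal Ω p := by
    refine ⟨(√(1 - ‖gradient u p‖ ^ 2))⁻¹ * l * ‖gradient ρ p‖, ?_⟩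
    rw [outwardNormal, ← hρ, smul_smul, mul_assoc, mul_inv_cancel₀ na, mul_one, mul_smul, ← hgr]
    rfl
  obtain ⟨m, hm⟩ := hX
  rw [hm, real_inner_smul_left, real_inner_self_eq_norm_sq, hN, one_pow, mul_one]

theorem divergence_eq_sum_inner {Y : EuclideanSpace ℝ (Fin n) → EuclideanSpace ℝ (Fin n)} :
    divergence Y p = ∑ i, inner ℝ (EuclideanSpace.single i (1 : ℝ))
      (fderiv ℝ Y p (EuclideanSpace.single i 1)) := by
  simp [divergence, partialDeriv, EuclideanSpace.inner_single_left]

theorem sum_inner_single_mul (y z : EuclideanSpace ℝ (Fin n)) :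
    ∑ i, inner ℝ y (EuclideanSpace.single i (1 : ℝ)) *
      inner ℝ (EuclideanSpace.single i (1 : ℝ)) z = inner ℝ y z := by
  simp [PiLp.inner_apply, mul_comm]

/-- For a field `X` that is normal to `∂Ω` on `∂Ω`, the normal component of `DX X - (div X) X` is
`-⟨X, ν⟩² div ν`. -/
theorem HasSmoothBoundary.inner_secondOrderField (hs : HasSmoothBoundary Ω) (hΩ : IsOpen Ω)
    (hp : p ∈ frontier Ω) {X : EuclideanSpace ℝ (Fin n) → EuclideanSpace ℝ (Fin n)}
    (hX : ContDiffAt ℝ ∞ X p)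
    (hXν : ∀ᶠ q in 𝓝 p, q ∈ frontier Ω →
      X q = inner ℝ (X q) (outwardNormal Ω q) • outwardNormal Ω q) :
    inner ℝ (secondOrderField X p) (outwardNormal Ω p) =
      -(inner ℝ (X p) (outwardNormal Ω p) ^ 2 *
        divergence (fun x => ‖gradient (boundaryDefiningFunction Ω p) x‖⁻¹ •
          gradient (boundaryDefiningFunction Ω p) x) p) := by
  have h := hs.isDefiningFunctionAt hp
  set ρ := boundaryDefiningFunction Ω p with hρ
  set N : EuclideanSpace ℝ (Fin n) → EuclideanSpace ℝ (Fin n) :=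
    fun x => ‖gradient ρ x‖⁻¹ • gradient ρ x with hNdef
  have hNp : outwardNormal Ω p = N p := rfl
  rw [hNp]
  have hg : ContDiffAt ℝ ∞ (gradient ρ) p := h.1.contDiffAt.gradient
  have hN : ContDiffAt ℝ ∞ N p :=
    ((hg.norm ℝ h.2.1).inv (norm_ne_zero_iff.2 h.2.1)).smul hg
  have hN1 : ∀ᶠ q in 𝓝 p, ‖N q‖ ^ 2 = 1 := by
    filter_upwards [h.eventually] with q hq
    have : ‖N q‖ = 1 := by
      rw [hNdef]
      simp only [norm_smul, norm_inv, norm_norm]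
      exact inv_mul_cancel₀ (norm_ne_zero_iff.2 hq.2.1)
    rw [this, one_pow]
  have hNN : inner ℝ (N p) (N p) = (1 : ℝ) := by
    rw [real_inner_self_eq_norm_sq, hN1.self_of_nhds]
  have hNd := hN.differentiableAt (by simp)
  have hXd := hX.differentiableAt (by simp)
  have hDN : ∀ v, inner ℝ (fderiv ℝ N p v) (N p) = (0 : ℝ) := fun v => by
    have h1 : fderiv ℝ (fun q => ‖N q‖ ^ 2) p = 0 := by
      have : (fun q => ‖N q‖ ^ 2) =ᶠ[𝓝 p] fun _ => (1 : ℝ) := hN1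
      rw [this.fderiv_eq]; simp
    have h2 := congrArg (fun L => L v) (hNd.hasFDerivAt.norm_sq.fderiv.symm.trans h1)
    rw [real_inner_comm]
    simpa using h2
  set a : EuclideanSpace ℝ (Fin n) → ℝ := fun q => inner ℝ (X q) (N q) with ha
  have haC : ContDiffAt ℝ ∞ a p := hX.inner ℝ hN
  have had := haC.differentiableAt (by simp)
  -- `N` extends the normal near `p` and `Z` vanishes on the boundary, so $DZ\,v=\langle N,v\rangle
  -- z$ for some vector $z$. Since $|N|=1$, at `p` one gets
  -- $\operatorname{div}X=D_Na+a\operatorname{div}N+\langle N,z\rangle$ and $\langle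
  -- DX\,X,N\rangle=a(D_Na+\langle N,z\rangle)$; only $-a^2\operatorname{div}N$ survives.
  set Z : EuclideanSpace ℝ (Fin n) → EuclideanSpace ℝ (Fin n) := fun q => X q - a q • N q with hZ
  have hZC : ContDiffAt ℝ ∞ Z p := hX.sub (haC.smul hN)
  have hZd := hZC.differentiableAt (by simp)
  have hZ0 : ∀ᶠ q in 𝓝 p, q ∈ frontier Ω → Z q = 0 := by
    filter_upwards [hXν, h.eventually] with q hq hq' hqf
    have := hq hqf
    rw [hs.outwardNormal_eq hΩ hqf hq'] at this
    exact sub_eq_zero.2 this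
  have hgN : gradient ρ p = ‖gradient ρ p‖ • N p := by
    simp only [hNdef]
    rw [smul_smul, mul_inv_cancel₀ (norm_ne_zero_iff.2 h.2.1), one_smul]
  have hDZ : ∃ z : EuclideanSpace ℝ (Fin n), ∀ v, fderiv ℝ Z p v = inner ℝ (N p) v • z := by
    have hi : ∀ i, ∃ l : ℝ, ∀ v, fderiv ℝ (fun q => Z q i) p v = l * inner ℝ (gradient ρ p) v :=
      fun i => h.exists_fderiv_eq_smul hΩ hp (contDiffAt_euclidean.1 hZC i)
        (hZ0.mono fun q hq hqf => by rw [hq hqf]; rfl)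
    choose l hl using hi
    refine ⟨WithLp.toLp 2 fun i => l i * ‖gradient ρ p‖, fun v => ?_⟩
    ext i
    rw [← fderiv_coord hZd, hl, hgN, real_inner_smul_left, ← hgN, PiLp.smul_apply, smul_eq_mul]
    ring
  clear_value N
  obtain ⟨z, hz⟩ := hDZ
  have hDX : ∀ v, fderiv ℝ X p v =
      fderiv ℝ a p v • N p + a p • fderiv ℝ N p v + inner ℝ (N p) v • z := by
    intro v
    have h1 : X = fun q => a q • N q + Z q := by
      ext1 q
      simp [hZ]
    rw [← hz]
    conv_lhs => rw [h1, fderiv_fun_add (had.fun_smul hNd) hZd, fderiv_fun_smul had hNd]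
    simp only [_root_.add_apply, _root_.smul_apply, ContinuousLinearMap.smulRight_apply]
    abel
  have hXp : X p = a p • N p := sub_eq_zero.1 (hZ0.self_of_nhds hp)
  have hdiv : divergence X p = fderiv ℝ a p (N p) + a p * divergence N p + inner ℝ (N p) z := by
    have e1 : ∑ i, fderiv ℝ a p (EuclideanSpace.single i 1) *
        inner ℝ (EuclideanSpace.single i (1 : ℝ)) (N p) = fderiv ℝ a p (N p) := by
      rw [map_eq_sum]
      simp [EuclideanSpace.inner_single_left, mul_comm]
    rw [divergence_eq_sum_inner, divergence_eq_sum_inner, ← e1, ← sum_inner_single_mul (N p) z,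
      Finset.mul_sum, ← Finset.sum_add_distrib, ← Finset.sum_add_distrib]
    refine Finset.sum_congr rfl fun i _ => ?_
    rw [hDX, inner_add_right, inner_add_right, inner_smul_right, inner_smul_right,
      inner_smul_right]
  have hXX : inner ℝ (fderiv ℝ X p (X p)) (N p) =
      a p * (fderiv ℝ a p (N p) + inner ℝ (N p) z) := by
    rw [hXp, map_smul, hDX, real_inner_smul_left, inner_add_left, inner_add_left,
      real_inner_smul_left, real_inner_smul_left, real_inner_smul_left, hDN, hNN,
      real_inner_comm z]
    ring
  have hap : inner ℝ (X p) (N p) = a p := rfl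
  rw [secondOrderField, inner_sub_left, hXX, real_inner_smul_left, hdiv, hap]
  ring

end Boundary

/-! ### The integral estimate -/

/-- The quadratic $t\mapsto\int(f-t)^2$ is nonnegative, so its discriminant is not positive. -/
theorem sq_integral_le {α : Type*} [MeasurableSpace α] {μ : Measure α} [IsFiniteMeasure μ]
    {f : α → ℝ} (hf : Integrable f μ) (hf2 : Integrable (fun x => f x ^ 2) μ) :
    (∫ x, f x ∂μ) ^ 2 ≤ μ.real Set.univ * ∫ x, f x ^ 2 ∂μ := by
  have key : ∀ t : ℝ, 0 ≤ μ.real Set.univ * (t * t) + (-2 * ∫ x, f x ∂μ) * t +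
      ∫ x, f x ^ 2 ∂μ := by
    intro t
    have h1 : 0 ≤ ∫ x, (f x - t) ^ 2 ∂μ := integral_nonneg fun x => sq_nonneg _
    have h2 : ∫ x, (f x - t) ^ 2 ∂μ =
        ∫ x, (f x ^ 2 + (-2 * t) * f x) + t ^ 2 ∂μ := by
      congr 1; ext x; ring
    have h3 : Integrable (fun x => f x ^ 2 + (-2 * t) * f x) μ := hf2.add (hf.const_mul _)
    rw [h2, integral_add h3 (integrable_const _),
      integral_add hf2 (hf.const_mul _), integral_const_mul, integral_const, smul_eq_mul] at h1
    linarith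
  have := discrim_le_zero key
  rw [discrim] at this
  linarith

/-- Passing to the lower integral allows a pointwise bound by $|H_0-H_{\partial\Omega}|$ without any
measurability of $H_{\partial\Omega}$. -/
theorem ofReal_integral_le_lintegral {α : Type*} [MeasurableSpace α] {μ : Measure α} {f : α → ℝ}
    (hf : Integrable f μ) : ENNReal.ofReal (∫ x, f x ∂μ) ≤ ∫⁻ x, ENNReal.ofReal (f x) ∂μ := by
  calc ENNReal.ofReal (∫ x, f x ∂μ) ≤ ENNReal.ofReal (∫ x, max (f x) 0 ∂μ) :=
        ENNReal.ofReal_le_ofReal (integral_mono hf hf.pos_part fun x => le_max_left _ _)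
    _ = ∫⁻ x, ENNReal.ofReal (max (f x) 0) ∂μ :=
        ofReal_integral_eq_lintegral_ofReal hf.pos_part (ae_of_all _ fun x => le_max_right _ _)
    _ = _ := by simp

section Estimate

variable {d : ℕ} {Ω V : Set (EuclideanSpace ℝ (Fin (d + 1)))}
  {u : EuclideanSpace ℝ (Fin (d + 1)) → ℝ} {c H K : ℝ}

theorem HasSmoothBoundary.lintegral_traceFreeForm_le (hs : HasSmoothBoundary Ω) (hΩ : IsOpen Ω)
    (hb : Bornology.IsBounded Ω) (hd : 0 < d) (hV : IsOpen V) (hΩV : closure Ω ⊆ V)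
    (hu : ContDiffOn ℝ ∞ u V) (hspace : ∀ x ∈ closure Ω, ‖gradient u x‖ < 1)
    (hc : ∀ x ∈ frontier Ω, u x = c) (hH : ∀ x ∈ Ω, meanCurvature u x = H)
    (hK : ∀ x ∈ frontier Ω, 1 / √(1 - ‖gradient u x‖ ^ 2) ≤ K) :
    ∫⁻ x in Ω, ENNReal.ofReal ((traceFreeForm u x * traceFreeForm u x).trace) ≤
      ENNReal.ofReal (d * K ^ 2) *
        ∫⁻ x, ‖referenceCurvature Ω - boundaryMeanCurvature Ω x‖ₑ ∂surfaceMeasure Ω := by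
  have hfin := hs.isFiniteMeasure hΩ hb
  have huV : ∀ x ∈ V, ContDiffAt ℝ ∞ u x := fun x hx => hu.contDiffAt (hV.mem_nhds hx)
  -- The space-like condition is given only on the closure of `Ω`; it persists on this smaller
  -- neighbourhood, where $X$ is smooth.
  set V' := V ∩ gradient u ⁻¹' Metric.ball 0 1 with hV'
  have hV'o : IsOpen V' := by
    refine ContinuousOn.isOpen_inter_preimage (fun x hx => ?_) hV Metric.isOpen_ball
    exact (huV x hx).gradient.continuousAt.continuousWithinAt
  have hV'u : ∀ x ∈ V', ContDiffAt ℝ ∞ u x ∧ ‖gradient u x‖ < 1 := fun x hx =>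
    ⟨huV x hx.1, by simpa using hx.2⟩
  have hcl : closure Ω ⊆ V' := fun x hx => ⟨hΩV hx, by simpa using hspace x hx⟩
  set X := slopeField u with hXdef
  have hX : ∀ x ∈ V', ContDiffAt ℝ ∞ X x := fun x hx =>
    contDiffAt_slopeField (hV'u x hx).1 (hV'u x hx).2
  have hY : ∀ x ∈ V', ContDiffAt ℝ ∞ (secondOrderField X) x := fun x hx =>
    contDiffAt_secondOrderField (hX x hx)
  set ν := outwardNormal Ω with hν
  have hνc := hs.continuousOn_outwardNormal hΩ
  have hXc : ContinuousOn X (frontier Ω) := fun x hx =>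
    (hX x (hcl (frontier_subset_closure hx))).continuousAt.continuousWithinAt
  have hYc : ContinuousOn (secondOrderField X) (frontier Ω) := fun x hx =>
    (hY x (hcl (frontier_subset_closure hx))).continuousAt.continuousWithinAt
  set a : EuclideanSpace ℝ (Fin (d + 1)) → ℝ := fun x => inner ℝ (X x) (ν x) with ha
  have hai : Integrable a (surfaceMeasure Ω) :=
    hs.integrable_of_continuousOn hΩ hb (hXc.inner hνc)
  have ha2i : Integrable (fun x => a x ^ 2) (surfaceMeasure Ω) :=
    hs.integrable_of_continuousOn hΩ hb ((hXc.inner hνc).pow 2)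
  have hYi : Integrable (fun x => inner ℝ (secondOrderField X x) (ν x)) (surfaceMeasure Ω) :=
    hs.integrable_of_continuousOn hΩ hb (hYc.inner hνc)
  have hdivX : ∀ x ∈ Ω, divergence X x = H := fun x hx => by
    obtain ⟨h1, h2⟩ := hV'u x (hcl (subset_closure hx))
    rw [← meanCurvature_eq_divergence h1 h2, hH x hx]
  have hΩfin : volume Ω < ⊤ := hb.measure_lt_top
  have hflux : ∫ x, a x ∂surfaceMeasure Ω = H * volume.real Ω := by
    rw [← hs.setIntegral_divergence_eq hΩ hb hV'o hcl (fun x hx =>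
      ((hX x hx).of_le (by simp)).contDiffWithinAt),
      setIntegral_congr_fun hΩ.measurableSet hdivX, setIntegral_const, smul_eq_mul, mul_comm]
  have hfluxY := hs.setIntegral_divergence_eq hΩ hb hV'o hcl (Y := secondOrderField X)
    (fun x hx => ((hY x hx).of_le (by simp)).contDiffWithinAt)
  have hdY : ContinuousOn (divergence (secondOrderField X)) (closure Ω) := fun x hx =>
    (contDiffAt_divergence (hY x (hcl hx))).continuousAt.continuousWithinAt
  have hdYi : IntegrableOn (divergence (secondOrderField X)) Ω :=
    (hdY.integrableOn_compact hb.isCompact_closure).mono_set subset_closure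
  set n : ℝ := ((d + 1 : ℕ) : ℝ) with hn
  have hn0 : 0 < n := by positivity
  have hnd : n - 1 = d := by rw [hn]; push_cast; ring
  have hT : ∀ x ∈ Ω, (traceFreeForm u x * traceFreeForm u x).trace =
      divergence (secondOrderField X) x + (H ^ 2 - H ^ 2 / n) := fun x hx => by
    obtain ⟨h1, h2⟩ := hV'u x (hcl (subset_closure hx))
    rw [trace_traceFreeForm_sq d.succ_ne_zero, hH x hx,
      divergence_secondOrderField (hX x (hcl (subset_closure hx))), hdivX x hx,
      shapeOperator_eq h1 h2]
    ring
  have hTi : IntegrableOn (fun x => (traceFreeForm u x * traceFreeForm u x).trace) Ω := by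
    refine IntegrableOn.congr_fun (f := fun x => divergence (secondOrderField X) x +
      (H ^ 2 - H ^ 2 / n)) (hdYi.add (integrableOn_const hΩfin.ne)) (fun x hx => (hT x hx).symm)
      hΩ.measurableSet
  have hTint : ∫ x in Ω, (traceFreeForm u x * traceFreeForm u x).trace =
      (∫ x, inner ℝ (secondOrderField X x) (ν x) ∂surfaceMeasure Ω) +
        (H ^ 2 - H ^ 2 / n) * volume.real Ω := by
    rw [setIntegral_congr_fun hΩ.measurableSet hT, integral_add hdYi
      (integrableOn_const hΩfin.ne), hfluxY, setIntegral_const, smul_eq_mul, mul_comm (H ^ 2 - _)]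
  have hCS : H ^ 2 / n * volume.real Ω ≤
      referenceCurvature Ω * ∫ x, a x ^ 2 ∂surfaceMeasure Ω := by
    have h1 := sq_integral_le hai ha2i
    rw [hflux] at h1
    -- If $|\Omega|=0$, then $H_0$ is 0 as a division by zero, and both sides vanish.
    rcases (measureReal_nonneg (μ := volume) (s := Ω)).eq_or_lt with h0 | h0
    · rw [referenceCurvature, ← h0]; simp
    · have e1 : referenceCurvature Ω * ∫ x, a x ^ 2 ∂surfaceMeasure Ω =
          ((surfaceMeasure Ω).real Set.univ * ∫ x, a x ^ 2 ∂surfaceMeasure Ω) /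
            (n * volume.real Ω) := by
        rw [referenceCurvature]; ring
      rw [e1, le_div_iff₀ (by positivity)]
      refine le_trans (le_of_eq ?_) h1
      field_simp
  -- The volume term $(H^2-H^2/n)|\Omega|=d\cdot\frac{H^2}{n}|\Omega|$, with $d=n-1$, is replaced by
  -- its Cauchy–Schwarz bound, a boundary integral.
  set g : EuclideanSpace ℝ (Fin (d + 1)) → ℝ := fun x =>
    inner ℝ (secondOrderField X x) (ν x) + d * referenceCurvature Ω * a x ^ 2 with hg
  have hgi : Integrable g (surfaceMeasure Ω) := hYi.add (ha2i.const_mul _)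
  have hTg : ∫ x in Ω, (traceFreeForm u x * traceFreeForm u x).trace ≤
      ∫ x, g x ∂surfaceMeasure Ω := by
    rw [hTint, hg, integral_add hYi (ha2i.const_mul _), integral_const_mul]
    have : (H ^ 2 - H ^ 2 / n) * volume.real Ω = d * (H ^ 2 / n * volume.real Ω) := by
      rw [← hnd]; field_simp
    rw [this, mul_assoc]
    gcongr
  have hgb : ∀ x ∈ frontier Ω, ENNReal.ofReal (g x) ≤
      ENNReal.ofReal (d * K ^ 2) * ‖referenceCurvature Ω - boundaryMeanCurvature Ω x‖ₑ := by
    intro x hx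
    have hxV := hcl (frontier_subset_closure hx)
    obtain ⟨h1, h2⟩ := hV'u x hxV
    have hXν : ∀ q ∈ frontier Ω, X q = inner ℝ (X q) (ν q) • ν q := fun q hq =>
      hs.slopeField_eq_smul hΩ hq (hV'u q (hcl (frontier_subset_closure hq))).1 hc
    have e1 := hs.inner_secondOrderField hΩ hx (hX x hxV) (Filter.Eventually.of_forall hXν)
    have e2 : d * boundaryMeanCurvature Ω x =
        divergence (fun y => ‖gradient (boundaryDefiningFunction Ω x) y‖⁻¹ •
          gradient (boundaryDefiningFunction Ω x) y) x := by
      have hd0 : (d : ℝ) ≠ 0 := by positivity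
      rw [boundaryMeanCurvature, ← hn, hnd]
      field_simp
    rw [← e2] at e1
    have e3 : g x = d * a x ^ 2 * (referenceCurvature Ω - boundaryMeanCurvature Ω x) := by
      simp only [hg]
      rw [e1]
      change -(a x ^ 2 * _) + _ = _
      ring
    -- As $X=a\nu$, one has $a^2=|X|^2=w^{-2}-1$.
    have ha2 : a x ^ 2 ≤ K ^ 2 := by
      have hw := lapse_pos h2
      have hw2 := lapse_sq h2
      have n1 : ‖X x‖ ^ 2 = a x ^ 2 := by
        rw [hXν x hx, norm_smul, hs.norm_outwardNormal hx, mul_one, Real.norm_eq_abs, sq_abs]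
      have n2 : ‖X x‖ ^ 2 = (1 / lapse u x) ^ 2 - 1 := by
        have : X x = (lapse u x)⁻¹ • gradient u x := rfl
        rw [this, norm_smul, norm_inv, Real.norm_eq_abs, abs_of_pos hw, mul_pow,
          show ‖gradient u x‖ ^ 2 = 1 - lapse u x ^ 2 by linarith]
        field_simp
      have n3 : (1 / lapse u x) ^ 2 ≤ K ^ 2 := pow_le_pow_left₀ (by positivity) (hK x hx) 2
      linarith
    rw [e3, ← ofReal_norm, ← ENNReal.ofReal_mul (by positivity), Real.norm_eq_abs]
    refine ENNReal.ofReal_le_ofReal ?_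
    refine (mul_le_mul_of_nonneg_left (le_abs_self _) (by positivity)).trans ?_
    gcongr
  calc ∫⁻ x in Ω, ENNReal.ofReal ((traceFreeForm u x * traceFreeForm u x).trace)
      = ENNReal.ofReal (∫ x in Ω, (traceFreeForm u x * traceFreeForm u x).trace) := by
        refine (ofReal_integral_eq_lintegral_ofReal hTi ?_).symm
        refine (ae_restrict_iff' hΩ.measurableSet).2 (ae_of_all _ fun x hx => ?_)
        obtain ⟨h1, h2⟩ := hV'u x (hcl (subset_closure hx))
        exact trace_traceFreeForm_sq_nonneg h1 h2
    _ ≤ ENNReal.ofReal (∫ x, g x ∂surfaceMeasure Ω) := ENNReal.ofReal_le_ofReal hTg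
    _ ≤ ∫⁻ x, ENNReal.ofReal (g x) ∂surfaceMeasure Ω := ofReal_integral_le_lintegral hgi
    _ ≤ ∫⁻ x, ENNReal.ofReal (d * K ^ 2) *
          ‖referenceCurvature Ω - boundaryMeanCurvature Ω x‖ₑ ∂surfaceMeasure Ω := by
        rw [surfaceMeasure_eq]
        exact setLIntegral_mono' isClosed_frontier.measurableSet hgb
    _ = _ := lintegral_const_mul' _ _ ENNReal.ofReal_ne_top

end Estimate

end SpacelikeGraph

theorem theorem5p3 (n : ℕ) (hn : 2 ≤ n) (K : ℝ) :
    ∃ C : ℝ, 0 < C ∧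
      ∀ (Ω V : Set (EuclideanSpace ℝ (Fin n))) (u : EuclideanSpace ℝ (Fin n) → ℝ) (c H : ℝ),
        -- `Ω` is a bounded domain with smooth boundary
        IsOpen Ω → Bornology.IsBounded Ω → SpacelikeGraph.HasSmoothBoundary Ω →
        -- `u` is smooth up to the boundary, that is, in a neighbourhood `V` of the closure
        IsOpen V → closure Ω ⊆ V → ContDiffOn ℝ ∞ u V →
        -- the graph `M` is space-like, and its boundary lies in the hyperplane `xₙ₊₁ = c`
        (∀ x ∈ closure Ω, ‖gradient u x‖ < 1) →
        (∀ x ∈ frontier Ω, u x = c) →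
        -- `M` has constant mean curvature
        (∀ x ∈ Ω, SpacelikeGraph.meanCurvature u x = H) →
        -- the gradient bound on the boundary
        (∀ x ∈ frontier Ω, 1 / √(1 - ‖gradient u x‖ ^ 2) ≤ K) →
        (∀ x ∈ Ω, SpacelikeGraph.divergence
            (fun y => (√(1 - ‖gradient u y‖ ^ 2))⁻¹ • gradient u y) x = H) ∧
          eLpNorm (SpacelikeGraph.traceFreeNorm u) 2 (volume.restrict Ω) ≤
            ENNReal.ofReal C *
              eLpNorm (fun x => SpacelikeGraph.referenceCurvature Ω -
                SpacelikeGraph.boundaryMeanCurvature Ω x) 1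
                (SpacelikeGraph.surfaceMeasure Ω) ^ (1 / 2 : ℝ) := by
  obtain ⟨d, rfl⟩ : ∃ d, n = d + 1 := ⟨n - 1, by omega⟩
  -- The estimate holds with $\sqrt{(n-1)K^2}$; the summand 1 only makes the constant positive when
  -- $K=0$.
  refine ⟨√(d * K ^ 2) + 1, by positivity, ?_⟩
  intro Ω V u c H hΩ hb hs hV hΩV hu hspace hc hH hK
  have hreg : ∀ x ∈ Ω, ContDiffAt ℝ ∞ u x ∧ ‖gradient u x‖ < 1 := fun x hx =>
    ⟨hu.contDiffAt (hV.mem_nhds (hΩV (subset_closure hx))), hspace x (subset_closure hx)⟩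
  refine ⟨fun x hx => ?_, ?_⟩
  · rw [← hH x hx, SpacelikeGraph.meanCurvature_eq_divergence (hreg x hx).1 (hreg x hx).2]
    rfl
  · have key := hs.lintegral_traceFreeForm_le hΩ hb (by omega) hV hΩV hu hspace hc hH hK
    have hsq : ∫⁻ x in Ω, ‖SpacelikeGraph.traceFreeNorm u x‖ₑ ^ (2 : ℝ) =
        ∫⁻ x in Ω, ENNReal.ofReal
          ((SpacelikeGraph.traceFreeForm u x * SpacelikeGraph.traceFreeForm u x).trace) := by
      refine setLIntegral_congr_fun hΩ.measurableSet fun x hx => ?_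
      have h0 := SpacelikeGraph.trace_traceFreeForm_sq_nonneg (hreg x hx).1 (hreg x hx).2
      rw [SpacelikeGraph.traceFreeNorm, Real.enorm_eq_ofReal (Real.sqrt_nonneg _),
        ENNReal.ofReal_rpow_of_nonneg (Real.sqrt_nonneg _) (by norm_num), Real.rpow_two,
        Real.sq_sqrt h0]
    rw [eLpNorm_one_eq_lintegral_enorm,
      eLpNorm_eq_lintegral_rpow_enorm_toReal two_ne_zero ENNReal.ofNat_ne_top, ENNReal.toReal_ofNat,
      hsq]
    calc _ ≤ _ := ENNReal.rpow_le_rpow key (by norm_num : (0 : ℝ) ≤ 1 / 2)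
      _ ≤ _ := by
        rw [ENNReal.mul_rpow_of_nonneg _ _ (by norm_num),
          ENNReal.ofReal_rpow_of_nonneg (by positivity) (by norm_num), ← Real.sqrt_eq_rpow]
        gcongr
        linarith
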